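/- **Conventions.** Let $(W,S)$ be a Coxeter system with length function $\ell$ and strong Bruhat order $\le$ (the transitive closure of $u<tu$ for $t$ a reflection with $\ell(u)<\ell(tu)$). For $J\subseteq S$ let $W^J=\{w\in W:\ell(ws)>\ell(w)\text{ for all }s\in J\}$, the set of minimal length representatives of the cosets $wW_J$. The relative $R$-polynomials $R^J_{u,v}(q)\in\mathbb Z[q]$ ($u,v\in W^J$) are those of type $x=-1$, that is, the unique family (Deodhar) such that, for all $u,v\in W^J$: $R^J_{u,v}=0$ if $u\not\le v$; $R^J_{u,u}=1$; and, if $u<v$ and $s\in S$ satisfies $sv<v$, $$R^{J}_{u,v}=\begin{cases}R^{J}_{su,sv}&\text{if }su<u,\\ q\,R^{J}_{u,sv}&\text{if }u<su\notin W^J,\\ (q-1)R^{J}_{u,sv}+q\,R^{J}_{su,sv}&\text{if }u<su\in W^J.\end{cases}$$ For $1\le p\le n$, let $W$ be of type $A_n$ with simple reflections $S=\{s_1,\dots,s_n\}$ (numbered along the Coxeter graph) and let $J=S\setminus\{s_p\}$; the quotient $W^J$ is denoted $A_n/A_{p-1}\times A_{n-p}$. Take the rectangle of boxes $(i,j)$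 with rows $1\le i\le n+1-p$ and columns $1\le j\le p$, and label the box $(i,j)$ by $s_{p+i-j}$. To a partition $\lambda=(\lambda_1\ge\dots\ge\lambda_k)$ whose Young diagram lies in this rectangle is attached the element $$w_\lambda=(r_1r_2\cdots r_k)^{-1}\in W^J,\qquad r_i=s_{p+i-1}s_{p+i-2}\cdots s_{p+i-\lambda_i},$$ where $r_i$ is the product of the labels of the $i$-th row of $\lambda$ from left to right. We say that $w_\lambda$ has shape $\lambda$; this gives a bijection between $W^J$ and the partitions in the rectangle. **Proposition.** In type $A$, $R^J_{u,v}(q)$ depends only on the skew shape $\lambda\setminus\mu$, where $\lambda$ and $\mu$ are the shapes of $v$ and $u$. Precisely: let $1\le p\le n$ and $1\le p'\le n'$, let $u<v$ in $A_n/A_{p-1}\times A_{n-p}$ have shapes $\mu$ and $\lambda$, and let $u'<v'$ in $A_{n'}/A_{p'-1}\times A_{n'-p'}$ have shapes $\mu'$ and $\lambda'$, and write $J$ and $J'$ for the corresponding sets of simple reflections. If the skew diagrams $\lambda\setminus\mu$ and $\lambda'\setminus\mu'$, as sets of boxes in the plane, are translates of each other (in particular, if they are equal), then $$R^J_{u,v}(q)=R^{J'}_{u',v'}(q).$$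 -/

import Mathlib

open scoped Polynomial

namespace RelativeR

section Coxeter

/- Conventions for a Coxeter system `cs` on `W` with simple reflections indexed by `B`. -/
variable {B : Type*} {W : Type*} [Group W] {M : CoxeterMatrix B}

/-- The strong Bruhat order: the reflexive transitive closure of `a → t * a`, for `t` a
reflection with `ℓ a < ℓ (t * a)`. -/
def BruhatLE (cs : CoxeterSystem M W) (u v : W) : Prop :=
  Relation.ReflTransGen
    (fun a b : W => cs.length a < cs.length b ∧ ∃ t : W, cs.IsReflection t ∧ t * a = b) u v

/-- The strict Bruhat order. -/
def BruhatLT (cs : CoxeterSystem M W) (u v : W) : Prop :=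
  BruhatLE cs u v ∧ u ≠ v

/-- `W^J`: the minimal length representatives of the cosets `w W_J`. -/
def minReps (cs : CoxeterSystem M W) (J : Set B) : Set W :=
  {w : W | ∀ j ∈ J, cs.length w < cs.length (w * cs.simple j)}

/-- If `v ∈ W^J` and `s` is a left descent of `v`, then `s v ∈ W^J`. -/
theorem simple_mul_mem_minReps (cs : CoxeterSystem M W) {J : Set B} {v : W}
    (hv : v ∈ minReps cs J) {i : B} (hi : cs.IsLeftDescent v i) :
    cs.simple i * v ∈ minReps cs J := by
  intro j hj
  have h1 := hv j hj
  have h2 : cs.length (cs.simple i * v) < cs.length v := hi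
  have h3 := cs.length_simple_mul (v * cs.simple j) i
  rw [← mul_assoc] at h3
  have h4 := cs.length_mul_simple_ne (cs.simple i * v) j
  omega

/-- The element `s v` of `W^J`, for `v ∈ W^J` and `s` a left descent of `v`. -/
def down (cs : CoxeterSystem M W) {J : Set B} (v : minReps cs J) (i : B)
    (hi : cs.IsLeftDescent (v : W) i) : minReps cs J :=
  ⟨cs.simple i * (v : W), simple_mul_mem_minReps cs v.2 hi⟩

/-- Deodhar's defining properties of the relative `R`-polynomials of type `x` of `W^J`;
the variable `q` is `Polynomial.X`, and `u < s u` says that `s` is not a left descent of `u`. -/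
structure IsRelativeRFamily (cs : CoxeterSystem M W) (J : Set B) (x : ℤ[X])
    (R : minReps cs J → minReps cs J → ℤ[X]) : Prop where
  eq_zero : ∀ u v : minReps cs J, ¬ BruhatLE cs (u : W) (v : W) → R u v = 0
  eq_one : ∀ u : minReps cs J, R u u = 1
  /-- `s v < v` and `s u < u` -/
  eq_of_descent : ∀ (u v : minReps cs J) (i : B), BruhatLT cs (u : W) (v : W) →
    ∀ (hv : cs.IsLeftDescent (v : W) i) (hu : cs.IsLeftDescent (u : W) i),
      R u v = R (down cs u i hu) (down cs v i hv)
  /-- `s v < v` and `u < s u ∉ W^J` -/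
  eq_of_not_mem : ∀ (u v : minReps cs J) (i : B), BruhatLT cs (u : W) (v : W) →
    ∀ hv : cs.IsLeftDescent (v : W) i, ¬ cs.IsLeftDescent (u : W) i →
      cs.simple i * (u : W) ∉ minReps cs J →
      R u v = (Polynomial.X - 1 - x) * R u (down cs v i hv)
  /-- `s v < v` and `u < s u ∈ W^J` -/
  eq_of_mem : ∀ (u v : minReps cs J) (i : B), BruhatLT cs (u : W) (v : W) →
    ∀ hv : cs.IsLeftDescent (v : W) i, ¬ cs.IsLeftDescent (u : W) i →
      ∀ hu : cs.simple i * (u : W) ∈ minReps cs J,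
      R u v = (Polynomial.X - 1) * R u (down cs v i hv)
        + Polynomial.X * R ⟨cs.simple i * (u : W), hu⟩ (down cs v i hv)

/-- There is at most one family with Deodhar's properties. -/
theorem IsRelativeRFamily.unique (cs : CoxeterSystem M W) {J : Set B} {x : ℤ[X]}
    {R R' : minReps cs J → minReps cs J → ℤ[X]}
    (h : IsRelativeRFamily cs J x R) (h' : IsRelativeRFamily cs J x R') : R = R' := by
  classical
  suffices H : ∀ (k : ℕ) (v : minReps cs J), cs.length (v : W) = k → ∀ u, R u v = R' u v by
    funext u v
    exact H _ v rfl u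
  intro k
  induction k using Nat.strong_induction_on with
  | _ k ih =>
    intro v hk u
    by_cases hle : BruhatLE cs (u : W) (v : W)
    swap
    · rw [h.eq_zero u v hle, h'.eq_zero u v hle]
    by_cases he : u = v
    · subst he
      rw [h.eq_one, h'.eq_one]
    have hlt : BruhatLT cs (u : W) (v : W) := ⟨hle, fun e => he (Subtype.ext e)⟩
    have hv1 : (v : W) ≠ 1 := by
      intro e
      rcases Relation.ReflTransGen.cases_tail hle with e' | ⟨c, _, hc, _⟩
      · exact hlt.2 e'.symm
      · rw [e, cs.length_one] at hc
        exact absurd hc (Nat.not_lt_zero _)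
    obtain ⟨i, hi⟩ := cs.exists_leftDescent_of_ne_one hv1
    have ihd := ih (cs.length (cs.simple i * (v : W))) (hk ▸ hi) (down cs v i hi) rfl
    by_cases hu : cs.IsLeftDescent (u : W) i
    · rw [h.eq_of_descent u v i hlt hi hu, h'.eq_of_descent u v i hlt hi hu, ihd]
    by_cases hm : cs.simple i * (u : W) ∈ minReps cs J
    · rw [h.eq_of_mem u v i hlt hi hu hm, h'.eq_of_mem u v i hlt hi hu hm, ihd, ihd]
    · rw [h.eq_of_not_mem u v i hlt hi hu hm, h'.eq_of_not_mem u v i hlt hi hu hm, ihd]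

open Classical in
/-- The relative `R`-polynomials of type `x` of `W^J`: the unique family with Deodhar's
properties (which exists by Deodhar's theorem). -/
noncomputable def relativeR (cs : CoxeterSystem M W) (J : Set B) (x : ℤ[X]) :
    minReps cs J → minReps cs J → ℤ[X] :=
  if h : ∃ R, IsRelativeRFamily cs J x R then h.choose else fun _ _ => 0

end Coxeter

section TypeA

/- The Grassmannian quotients in type `A_n`. The simple reflections `s_1, …, s_n` are indexed
here by `Fin n`, so that `p : Fin n` stands for the maximal parabolic that omits `s_{p+1}`, and
the diagram of the quotient is a rectangle with `n - p` rows and `p + 1` columns. Boxes are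
`(row, column)`, counted from `0`. -/
variable {n : ℕ} {W : Type*} [Group W]

/-- The set `J` of all simple reflections but the one with index `p`. -/
def grassJ (p : Fin n) : Set (Fin n) := {p}ᶜ

/-- The simple reflection with index `k` (and `1` if `k` is out of range). -/
def gen (cs : CoxeterSystem (CoxeterMatrix.A n) W) (k : ℕ) : W :=
  if h : k < n then cs.simple ⟨k, h⟩ else 1

/-- `lam` fits into the rectangle with `n - p` rows and `p + 1` columns. -/
def FitsIn (p : Fin n) (lam : YoungDiagram) : Prop :=
  ∀ c ∈ lam.cells, c.1 + (p : ℕ) < n ∧ c.2 ≤ (p : ℕ)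

/-- The product of the first `l` labels of row `i`, from left to right. The box `(i, j)` of the
rectangle has the label `p + i - j`. -/
def rowWord (cs : CoxeterSystem (CoxeterMatrix.A n) W) (p : Fin n) (i l : ℕ) : W :=
  ((List.range l).map fun j => gen cs ((p : ℕ) + i - j)).prod

/-- The element attached to a diagram: the inverse of the product of its row words, from the top
row to the bottom row. -/
def diagramElt (cs : CoxeterSystem (CoxeterMatrix.A n) W) (p : Fin n) (lam : YoungDiagram) : W :=
  (((List.range (lam.colLen 0)).map fun i => rowWord cs p i (lam.rowLen i)).prod)⁻¹

/-- `lam` is the shape of `w`: the diagram of the rectangle to which `w` corresponds. -/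
def HasShape (cs : CoxeterSystem (CoxeterMatrix.A n) W) (p : Fin n) (w : W)
    (lam : YoungDiagram) : Prop :=
  FitsIn p lam ∧ w = diagramElt cs p lam

end TypeA

/-- The boxes of the skew diagram `lam \ mu`, in the plane. -/
def skewBoxes (lam mu : YoungDiagram) : Set (ℤ × ℤ) :=
  {b | ∃ c ∈ lam.cells \ mu.cells, b = ((c.1 : ℤ), (c.2 : ℤ))}

/-- `lam \ mu` and `lam' \ mu'` have the same skew shape: one is a translate of the other. -/
def SameSkewShape (lam mu lam' mu' : YoungDiagram) : Prop :=
  ∃ t : ℤ × ℤ, skewBoxes lam' mu' = (fun b => b + t) '' skewBoxes lam mu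

end RelativeR

/-! An element of `W^J` is recorded by the boundary of its diagram, the function sending each
diagonal to the first free row on it. The group acts on these paths: a simple reflection exchanges
the two steps meeting at its diagonal (`toggle`), so the path depends only on the coset. For a
minimal representative `u`, the reflection `s` is a left descent iff a box can be removed on its
diagonal; `s u` is longer and still minimal iff a box can be added; otherwise `s u = u s'` with `s'`
in `W_J`. Bruhat order becomes containment of diagrams. Deodhar's recursion thus turns into a
recursion `pathR` on pairs of paths that mentions neither `n` nor `p` (`relativeR_eq_pathR`).

This recursion is local. When a corner of the skew diagram is peeled off the larger diagram, the
case that applies to the smaller one is decided by the skew diagram near that corner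
(`SkewTranslate.removable_upper`, `SkewTranslate.removable_lower`, `SkewTranslate.addable_lower`).
The translated corner therefore falls under the same case, and induction on the number of boxes
gives `pathR_eq_of_skewTranslate`.

Two points need work. The path recursion must not depend on the corner peeled: recursion operators
on distant diagonals commute (`farComm_deodharOp`), and this suffices because two corners of a
diagram are never on adjacent diagonals (`Builds.unique`). The identification of `W^J` and its order
with diagrams uses the strong exchange condition, obtained from a sign cocycle on reflections
(`exists_eraseIdx_of_length_mul_lt`). -/

namespace RelativeR

/-! ### Strong exchange and the subword property in a general Coxeter group. -/

section Exchange

variable {B : Type*} {W : Type*} [Group W] {M : CoxeterMatrix B}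

open Classical in
/-- The action of a simple reflection on pairs of a group element and a sign, by conjugation;
the sign changes at the reflection itself. -/
noncomputable def signedConj (cs : CoxeterSystem M W) (i : B) : Function.End (W × ZMod 2) :=
  fun x => (cs.simple i * x.1 * cs.simple i, x.2 + if x.1 = cs.simple i then 1 else 0)

theorem mul_inv_pow_conj {a b : W} (ha : a * a = 1) (hb : b * b = 1) (k : ℕ) :
    ((a * b) ^ k)⁻¹ * b * (a * b) ^ k = ((a * b)⁻¹) ^ (2 * k) * b := by
  have hb' : b⁻¹ = b := inv_eq_of_mul_eq_one_left hb
  have ha' : a⁻¹ = a := inv_eq_of_mul_eq_one_left ha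
  have h : b * (a * b) ^ k = ((a * b)⁻¹) ^ k * b := by
    have : SemiconjBy b (a * b) (a * b)⁻¹ := by
      simp [SemiconjBy, mul_inv_rev, ha', hb', mul_assoc]
    exact this.pow_right k
  rw [mul_assoc, h, ← inv_pow, two_mul, pow_add, mul_assoc]

-- The sign flips when the conjugated element meets `s_j` or `s_i`. Pulled back to the starting
-- element, the `2k` tests compare it with the successive elements `(s_j s_i)^a s_j` of the dihedral
-- subgroup.
open Classical in
theorem signedConj_mul_pow (cs : CoxeterSystem M W) (i j : B) (k : ℕ) (x : W × ZMod 2) :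
    ((signedConj cs i * signedConj cs j) ^ k) x =
      ((cs.simple i * cs.simple j) ^ k * x.1 * ((cs.simple i * cs.simple j) ^ k)⁻¹,
        x.2 + ∑ a ∈ Finset.range (2 * k),
          if x.1 = ((cs.simple i * cs.simple j)⁻¹) ^ a * cs.simple j then 1 else 0) := by
  induction k with
  | zero => simp; rfl
  | succ k ih =>
    set r := cs.simple i * cs.simple j with hr
    have hj := cs.simple_mul_simple_self j
    have key := mul_inv_pow_conj (cs.simple_mul_simple_self i) hj k
    rw [← hr] at key
    have e1 : r ^ k * x.1 * (r ^ k)⁻¹ = cs.simple j ↔ x.1 = r⁻¹ ^ (2 * k) * cs.simple j := by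
      rw [← key]
      constructor
      · intro h; rw [← h]; group
      · intro h; rw [h]; group
    have e2 : cs.simple j * (r ^ k * x.1 * (r ^ k)⁻¹) * cs.simple j = cs.simple i ↔
        x.1 = r⁻¹ ^ (2 * k + 1) * cs.simple j := by
      have e : r⁻¹ ^ (2 * k + 1) * cs.simple j =
          (r ^ k)⁻¹ * (cs.simple j * cs.simple i * cs.simple j) * r ^ k := by
        have h2 : cs.simple j * cs.simple i * cs.simple j = r⁻¹ * cs.simple j := by
          simp [hr, mul_inv_rev]
        rw [h2, pow_succ', mul_assoc, ← key]
        simp only [← inv_pow, ← mul_assoc]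
        rw [← pow_succ, ← pow_succ']
      rw [e]
      constructor
      · intro h; rw [← h]; simp [mul_assoc]
      · intro h; rw [h]; simp [mul_assoc]
    rw [pow_succ']
    change signedConj cs i (signedConj cs j (((signedConj cs i * signedConj cs j) ^ k) x)) = _
    rw [ih, signedConj, signedConj]
    refine Prod.ext ?_ ?_
    · simp only [pow_succ', mul_inv_rev, cs.inv_simple, mul_assoc, hr]
    · simp only [e1, e2]
      rw [show 2 * (k + 1) = 2 * k + 1 + 1 by ring, Finset.sum_range_succ, Finset.sum_range_succ]
      ring

/-- For `k = M i j` the second half of the `2k` tests repeats the first, because the rotation has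
become trivial; the sign changes cancel modulo 2. -/
theorem isLiftable_signedConj (cs : CoxeterSystem M W) : M.IsLiftable (signedConj cs) := by
  classical
  intro i j
  funext x
  rw [signedConj_mul_pow, cs.simple_mul_simple_pow, two_mul, Finset.sum_range_add]
  have h : (cs.simple i * cs.simple j)⁻¹ ^ (M i j) = 1 := by
    rw [inv_pow, cs.simple_mul_simple_pow, inv_one]
  simp only [pow_add, h, one_mul, CharTwo.add_self_eq_zero]
  simp
  rfl

/-- The reflection cocycle, as a homomorphism. -/
noncomputable def signedConjHom (cs : CoxeterSystem M W) : W →* Function.End (W × ZMod 2) :=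
  cs.lift ⟨signedConj cs, isLiftable_signedConj cs⟩

theorem signedConjHom_simple (cs : CoxeterSystem M W) (i : B) :
    signedConjHom cs (cs.simple i) = signedConj cs i :=
  cs.lift_apply_simple _ i

-- The parity of the occurrences of an element in the right inversion sequence is read off from a
-- homomorphism, hence depends on the group element and not on the word.
open Classical in
theorem signedConjHom_wordProd (cs : CoxeterSystem M W) (w : List B) (x : W × ZMod 2) :
    signedConjHom cs (cs.wordProd w) x =
      (cs.wordProd w * x.1 * (cs.wordProd w)⁻¹, x.2 + ((cs.rightInvSeq w).count x.1 : ZMod 2)) := by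
  induction w with
  | nil => simp; rfl
  | cons i w ih =>
    rw [cs.wordProd_cons, map_mul]
    change signedConjHom cs (cs.simple i) (signedConjHom cs (cs.wordProd w) x) = _
    rw [ih, signedConjHom_simple, signedConj]
    have e : cs.wordProd w * x.1 * (cs.wordProd w)⁻¹ = cs.simple i ↔
        (cs.wordProd w)⁻¹ * cs.simple i * cs.wordProd w = x.1 := by
      constructor
      · intro h; rw [← h]; group
      · intro h; rw [← h]; group
    refine Prod.ext ?_ ?_
    · simp [mul_assoc]
    · simp only [CoxeterSystem.rightInvSeq, List.count_cons, e, beq_iff_eq]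
      split_ifs <;> simp [add_assoc]

theorem signedConjHom_eq (cs : CoxeterSystem M W) (w t : W) (e : ZMod 2) :
    signedConjHom cs w (t, e) = (w * t * w⁻¹, e + (signedConjHom cs w (t, 0)).2) := by
  classical
  obtain ⟨l, rfl⟩ := cs.wordProd_surjective w
  simp [signedConjHom_wordProd]

/-- Write `t = w s w⁻¹`. The signs contributed by `w⁻¹` and `w` cancel, as they do in `w w⁻¹ = 1`;
only the flip of `s` at itself remains. -/
theorem signedConjHom_reflection (cs : CoxeterSystem M W) {t : W} (ht : cs.IsReflection t) :
    (signedConjHom cs t (t, 0)).2 = 1 := by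
  obtain ⟨w, i, rfl⟩ := ht
  set t := w * cs.simple i * w⁻¹ with hteq
  have h1 : signedConjHom cs w (signedConjHom cs w⁻¹ (t, 0)) = (t, 0) := by
    change (signedConjHom cs w * signedConjHom cs w⁻¹) (t, 0) = _
    rw [← map_mul, mul_inv_cancel, map_one]
    rfl
  have h2 : w⁻¹ * t * w⁻¹⁻¹ = cs.simple i := by rw [hteq]; group
  have h3 : signedConjHom cs t (t, 0) =
      signedConjHom cs w (signedConjHom cs (cs.simple i) (signedConjHom cs w⁻¹ (t, 0))) := by
    change _ = (signedConjHom cs w * (signedConjHom cs (cs.simple i) * signedConjHom cs w⁻¹)) _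
    rw [← map_mul, ← map_mul, hteq, mul_assoc]
  rw [signedConjHom_eq cs w⁻¹, h2, signedConjHom_eq cs w] at h1
  have h4 := congrArg Prod.snd h1
  simp only at h4
  rw [h3, signedConjHom_eq cs w⁻¹, h2, signedConjHom_simple, signedConj]
  simp only [if_true, cs.simple_mul_simple_self, one_mul]
  rw [signedConjHom_eq cs w]
  linear_combination h4

/-- The strong exchange condition, for words that need not be reduced. -/
theorem exists_eraseIdx_of_length_mul_lt (cs : CoxeterSystem M W) (w : List B) {t : W}
    (ht : cs.IsReflection t) (h : cs.length (cs.wordProd w * t) < cs.length (cs.wordProd w)) :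
    ∃ j < w.length, cs.wordProd w * t = cs.wordProd (w.eraseIdx j) := by
  classical
  have main : ∀ l : List B, (signedConjHom cs (cs.wordProd l) (t, 0)).2 ≠ 0 →
      ∃ j < l.length, cs.wordProd l * t = cs.wordProd (l.eraseIdx j) := by
    intro l hl
    rw [signedConjHom_wordProd] at hl
    have hmem : t ∈ cs.rightInvSeq l := by
      by_contra hn
      exact hl (by simp [List.count_eq_zero_of_not_mem hn])
    obtain ⟨j, hj, rfl⟩ := List.mem_iff_getElem.mp hmem
    refine ⟨j, by simpa using hj, ?_⟩
    rw [← cs.wordProd_mul_getD_rightInvSeq, List.getD_eq_getElem _ 1 hj]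
  apply main
  -- If `t` had sign 0 for the product `w`, it would have sign 1 for `w t`. Deleting a letter from a
  -- reduced word of `w t` would then give `w`, contradicting that `w t` is the shorter one.
  intro h0
  obtain ⟨l, hl, hw⟩ := cs.exists_isReduced (cs.wordProd w * t)
  have h1 : (signedConjHom cs (cs.wordProd l) (t, 0)).2 = 1 := by
    rw [← hw, map_mul]
    change (signedConjHom cs (cs.wordProd w) (signedConjHom cs t (t, 0))).2 = 1
    rw [signedConjHom_eq cs t, signedConjHom_reflection cs ht, ht.mul_self, one_mul, ht.inv,
      signedConjHom_eq, h0]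
    simp
  obtain ⟨j, hj, he⟩ := main l (by rw [h1]; exact one_ne_zero)
  rw [← hw, mul_assoc, ht.mul_self, mul_one] at he
  have h2 := cs.length_wordProd_le (l.eraseIdx j)
  rw [← he, List.length_eraseIdx_of_lt hj] at h2
  have h3 : cs.length (cs.wordProd w * t) = l.length := by rw [hw]; exact hl
  omega

/-- If `u ≤ v` in the Bruhat order, then every word for `v` has a subword for `u`. -/
theorem exists_sublist_of_bruhatLE (cs : CoxeterSystem M W) {u v : W} (h : BruhatLE cs u v)
    (w : List B) (hw : cs.wordProd w = v) : ∃ w' : List B, w'.Sublist w ∧ cs.wordProd w' = u := by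
  induction h using Relation.ReflTransGen.head_induction_on with
  | refl => exact ⟨w, List.Sublist.refl _, hw⟩
  | @head a c hac _ ih =>
    obtain ⟨w', hs, rfl⟩ := ih
    obtain ⟨hlt, t, ht, hta⟩ := hac
    have ha : a = t * cs.wordProd w' := by
      rw [← hta, ← mul_assoc, ht.mul_self, one_mul]
    -- Bruhat steps multiply on the left and exchange is stated on the right, so the reflection is
    -- conjugated across.
    have ht' : cs.IsReflection ((cs.wordProd w')⁻¹ * t * (cs.wordProd w')⁻¹⁻¹) := ht.conj _
    have e : cs.wordProd w' * ((cs.wordProd w')⁻¹ * t * (cs.wordProd w')⁻¹⁻¹) = a := by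
      rw [ha]; group
    obtain ⟨j, _, hj⟩ := exists_eraseIdx_of_length_mul_lt cs w' ht' (by rw [e]; exact hlt)
    exact ⟨_, (List.eraseIdx_sublist _ _).trans hs, by rw [← hj, e]⟩

end Exchange

/-! ### Lattice paths of diagrams, and building them box by box. -/

section Paths

/-- The lattice path of the empty diagram. The path of a diagram sends `d` to the first row in
which the diagonal `row - column = d` is not occupied. -/
def ground : ℤ → ℤ := fun d => max d 0

/-- Add or remove the box at the end of the diagonal `d`, if possible. -/
def toggle (d : ℤ) (b : ℤ → ℤ) : ℤ → ℤ :=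
  Function.update b d (b (d - 1) + b (d + 1) - b d)

/-- A box can be added on the diagonal `d`. -/
def Addable (d : ℤ) (b : ℤ → ℤ) : Prop := b (d - 1) = b d ∧ b (d + 1) = b d + 1

/-- A box can be removed from the diagonal `d`. -/
def Removable (d : ℤ) (b : ℤ → ℤ) : Prop := b (d - 1) = b d - 1 ∧ b (d + 1) = b d

theorem toggle_apply (d : ℤ) (b : ℤ → ℤ) (x : ℤ) :
    toggle d b x = if x = d then b (d - 1) + b (d + 1) - b d else b x := by
  simp [toggle, Function.update_apply]

theorem toggle_self (d : ℤ) (b : ℤ → ℤ) : toggle d b d = b (d - 1) + b (d + 1) - b d := by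
  simp [toggle_apply]

theorem toggle_of_ne {d x : ℤ} (b : ℤ → ℤ) (h : x ≠ d) : toggle d b x = b x := by
  simp [toggle_apply, h]

theorem toggle_toggle (d : ℤ) (b : ℤ → ℤ) : toggle d (toggle d b) = b := by
  funext x
  have h1 : d - 1 ≠ d := by omega
  have h2 : d + 1 ≠ d := by omega
  by_cases h : x = d
  · subst h
    rw [toggle_self, toggle_self, toggle_of_ne b h1, toggle_of_ne b h2]
    ring
  · rw [toggle_of_ne _ h, toggle_of_ne _ h]

theorem toggle_comm {d e : ℤ} (h : 2 ≤ |d - e|) (b : ℤ → ℤ) :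
    toggle d (toggle e b) = toggle e (toggle d b) := by
  have h' : 2 ≤ d - e ∨ 2 ≤ e - d := by rcases le_abs.mp h with h | h <;> omega
  funext x
  simp only [toggle_apply]
  grind

theorem removable_toggle_iff {d e : ℤ} (h : 2 ≤ |d - e|) (b : ℤ → ℤ) :
    Removable d (toggle e b) ↔ Removable d b := by
  have h' : 2 ≤ d - e ∨ 2 ≤ e - d := by rcases le_abs.mp h with h | h <;> omega
  simp only [Removable, toggle_apply]
  grind

theorem addable_toggle_iff {d e : ℤ} (h : 2 ≤ |d - e|) (b : ℤ → ℤ) :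
    Addable d (toggle e b) ↔ Addable d b := by
  have h' : 2 ≤ d - e ∨ 2 ≤ e - d := by rcases le_abs.mp h with h | h <;> omega
  simp only [Addable, toggle_apply]
  grind

theorem Addable.toggle_self {d : ℤ} {b : ℤ → ℤ} (h : Addable d b) : toggle d b d = b d + 1 := by
  rw [RelativeR.toggle_self, h.1, h.2]; ring

theorem Removable.toggle_self {d : ℤ} {b : ℤ → ℤ} (h : Removable d b) :
    toggle d b d = b d - 1 := by
  rw [RelativeR.toggle_self, h.1, h.2]; ring

theorem Addable.removable_toggle {d : ℤ} {b : ℤ → ℤ} (h : Addable d b) :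
    Removable d (toggle d b) := by
  refine ⟨?_, ?_⟩
  · rw [h.toggle_self, toggle_of_ne b (by omega), h.1]; ring
  · rw [h.toggle_self, toggle_of_ne b (by omega), h.2]

theorem Removable.addable_toggle {d : ℤ} {b : ℤ → ℤ} (h : Removable d b) :
    Addable d (toggle d b) := by
  refine ⟨?_, ?_⟩
  · rw [h.toggle_self, toggle_of_ne b (by omega), h.1]
  · rw [h.toggle_self, toggle_of_ne b (by omega), h.2]; ring

theorem Addable.not_removable {d : ℤ} {b : ℤ → ℤ} (h : Addable d b) : ¬ Removable d b := by
  intro h'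
  have := h.1
  have := h'.1
  omega

theorem not_removable_ground (d : ℤ) : ¬ Removable d ground := by
  simp only [Removable, ground]
  omega

/-- The steps of a lattice path. -/
def IsPath (b : ℤ → ℤ) : Prop := ∀ d, b d ≤ b (d + 1) ∧ b (d + 1) ≤ b d + 1

theorem IsPath.left {b : ℤ → ℤ} (h : IsPath b) (d : ℤ) :
    b (d - 1) ≤ b d ∧ b d ≤ b (d - 1) + 1 := by
  simpa using h (d - 1)

theorem isPath_ground : IsPath ground := by
  intro d
  simp only [ground]
  omega

/-- A toggle only exchanges the two steps that meet at `d`. -/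
theorem IsPath.toggle {b : ℤ → ℤ} (h : IsPath b) (d : ℤ) : IsPath (toggle d b) := by
  intro x
  have h1 := h x
  have h2 := h.left d
  have h3 := h d
  simp only [toggle_apply]
  grind

/-- A straight step: no box can be added or removed on the diagonal `d`. -/
theorem IsPath.toggle_eq_self {b : ℤ → ℤ} (h : IsPath b) {d : ℤ} (ha : ¬ Addable d b)
    (hr : ¬ Removable d b) : RelativeR.toggle d b = b := by
  funext x
  have h2 := h.left d
  have h3 := h d
  simp only [Addable, Removable] at ha hr
  rw [toggle_apply]
  split_ifs with hx
  · subst hx; omega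
  · rfl

/-- `Builds g x₀ b x`: the path `b` arises from the ground path by adding boxes, and `x` arises
from `x₀` by the corresponding operations `g d`. -/
inductive Builds {X : Type*} (g : ℤ → X → X) (x₀ : X) : (ℤ → ℤ) → X → Prop
  | ground : Builds g x₀ ground x₀
  | add {b : ℤ → ℤ} {x : X} (d : ℤ) : Builds g x₀ b x → Addable d b →
      Builds g x₀ (toggle d b) (g d x)

/-- Operations at distant diagonals commute. -/
def FarComm {X : Type*} (g : ℤ → X → X) : Prop :=
  ∀ d e, 2 ≤ |d - e| → ∀ x, g d (g e x) = g e (g d x)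

/-- Any corner can be taken as the last box added: if another box came last, the two lie on distant
diagonals and their operations can be swapped. -/
theorem Builds.exists_of_removable {X : Type*} {g : ℤ → X → X} {x₀ : X} (hg : FarComm g)
    {b : ℤ → ℤ} {x : X} (h : Builds g x₀ b x) :
    ∀ {d : ℤ}, Removable d b → ∃ z, Builds g x₀ (toggle d b) z ∧ x = g d z := by
  induction h with
  | ground => intro d hd; exact absurd hd (not_removable_ground d)
  | @add b x e h hadd ih =>
    intro d hd
    by_cases hde : d = e
    · subst hde
      exact ⟨x, by rwa [toggle_toggle], rfl⟩
    have hre := hadd.removable_toggle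
    -- Corners on adjacent diagonals would require the step between them to be both flat and rising.
    have far : 2 ≤ |d - e| := by
      by_contra hlt
      have hlt' := abs_lt.mp (not_le.mp hlt)
      rcases (by omega : d = e + 1 ∨ d = e - 1) with rfl | rfl
      · have h1 := hd.1
        have h2 := hre.2
        rw [add_sub_cancel_right] at h1
        omega
      · have h1 := hd.2
        have h2 := hre.1
        rw [sub_add_cancel] at h1
        omega
    have far' : 2 ≤ |e - d| := by rwa [abs_sub_comm]
    obtain ⟨z, hz, rfl⟩ := ih ((removable_toggle_iff far b).mp hd)
    refine ⟨g e z, ?_, hg _ _ far' _⟩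
    rw [toggle_comm far]
    exact hz.add e ((addable_toggle_iff far' b).mpr hadd)

theorem Builds.unique {X : Type*} {g : ℤ → X → X} {x₀ : X} (hg : FarComm g)
    {b : ℤ → ℤ} {x y : X} (hx : Builds g x₀ b x) (hy : Builds g x₀ b y) : x = y := by
  induction hx generalizing y with
  | ground =>
    generalize hb : RelativeR.ground = b at hy
    cases hy with
    | ground => rfl
    | add d h hadd => exact absurd (hb ▸ hadd.removable_toggle) (not_removable_ground d)
  | add d h hadd ih =>
    obtain ⟨z, hz, rfl⟩ := hy.exists_of_removable hg hadd.removable_toggle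
    rw [toggle_toggle] at hz
    rw [ih hz]

theorem Builds.isPath {X : Type*} {g : ℤ → X → X} {x₀ : X} {b : ℤ → ℤ} {x : X}
    (h : Builds g x₀ b x) : IsPath b := by
  induction h with
  | ground => exact isPath_ground
  | add d _ _ ih => exact ih.toggle d

theorem Builds.exists_builds {X Y : Type*} {g : ℤ → X → X} {x₀ : X} {b : ℤ → ℤ} {x : X}
    (h : Builds g x₀ b x) (f : ℤ → Y → Y) (y₀ : Y) : ∃ y, Builds f y₀ b y := by
  induction h with
  | ground => exact ⟨y₀, .ground⟩
  | add d _ hadd ih =>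
    obtain ⟨y, hy⟩ := ih
    exact ⟨_, hy.add d hadd⟩

theorem le_toggle_of_addable {d : ℤ} {b : ℤ → ℤ} (h : Addable d b) : b ≤ toggle d b := by
  intro x
  by_cases hx : x = d
  · subst hx; rw [h.toggle_self]; exact (lt_add_one _).le
  · rw [toggle_of_ne b hx]

theorem Builds.ground_le {X : Type*} {g : ℤ → X → X} {x₀ : X} {b : ℤ → ℤ} {x : X}
    (h : Builds g x₀ b x) : RelativeR.ground ≤ b := by
  induction h with
  | ground => exact le_rfl
  | add d _ hadd ih => exact ih.trans (le_toggle_of_addable hadd)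

/-- The number of boxes, as a relation. -/
abbrev HasSize (b : ℤ → ℤ) (k : ℕ) : Prop := Builds (fun _ m => m + 1) 0 b k

theorem farComm_succ : FarComm (fun (_ : ℤ) (m : ℕ) => m + 1) := fun _ _ _ _ => rfl

theorem HasSize.toggle {b : ℤ → ℤ} {k : ℕ} (h : HasSize b k) (d : ℤ) :
    ∃ m ≤ k + 1, HasSize (toggle d b) m := by
  by_cases ha : Addable d b
  · exact ⟨k + 1, le_rfl, h.add d ha⟩
  by_cases hr : Removable d b
  · obtain ⟨z, hz, rfl⟩ := h.exists_of_removable farComm_succ hr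
    exact ⟨z, by omega, hz⟩
  · exact ⟨k, by omega, by rwa [h.isPath.toggle_eq_self ha hr]⟩

/-- The last box of an occupied diagonal `d` has row plus column `2 * b d - d - 2`, and a diagram
has finitely many boxes. The bound makes the search for a corner terminate. -/
theorem Builds.exists_content_le {X : Type*} {g : ℤ → X → X} {x₀ : X} {b : ℤ → ℤ} {x : X}
    (h : Builds g x₀ b x) : ∃ K : ℤ, ∀ d, RelativeR.ground d < b d → 2 * b d - d ≤ K := by
  induction h with
  | ground => exact ⟨0, fun d hd => absurd hd (lt_irrefl _)⟩
  | @add b x e h hadd ih =>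
    obtain ⟨K, hK⟩ := ih
    refine ⟨max K (2 * (b e + 1) - e), fun d hd => ?_⟩
    by_cases hde : d = e
    · subst hde; rw [hadd.toggle_self]; exact le_max_right _ _
    · rw [toggle_of_ne b hde] at hd ⊢
      exact (hK d hd).trans (le_max_left _ _)

/-- A nonempty skew diagram has a corner. -/
theorem Builds.exists_removable_of_lt {X : Type*} {g : ℤ → X → X} {x₀ : X} {b : ℤ → ℤ} {x : X}
    (h : Builds g x₀ b x) {c : ℤ → ℤ} (hc : IsPath c) (hg : RelativeR.ground ≤ c) {d : ℤ}
    (hd : c d < b d) : ∃ e, Removable e b ∧ c e < b e := by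
  obtain ⟨K, hK⟩ := h.exists_content_le
  -- If the last box on `d` is not a corner, a neighbouring diagonal still has `c < b` and its value
  -- of `2 * b d - d` is larger by 1.
  suffices H : ∀ (m : ℕ) (d : ℤ), c d < b d → K - (2 * b d - d) ≤ m →
      ∃ e, Removable e b ∧ c e < b e from
    H (K - (2 * b d - d)).toNat d hd (Int.self_le_toNat _)
  intro m
  induction m with
  | zero =>
    intro d hd hm
    refine ⟨d, ⟨?_, ?_⟩, hd⟩
    · by_contra hne
      have h1 := h.isPath.left d
      have h2 := hc.left d
      have h3 := hK (d - 1) (lt_of_le_of_lt (b := c (d - 1)) (hg _) (by omega))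
      push_cast at hm
      omega
    · by_contra hne
      have h1 := h.isPath d
      have h2 := hc d
      have h3 := hK (d + 1) (lt_of_le_of_lt (b := c (d + 1)) (hg _) (by omega))
      push_cast at hm
      omega
  | succ m ih =>
    intro d hd hm
    have h1 := h.isPath.left d
    have h2 := hc.left d
    have h3 := h.isPath d
    have h4 := hc d
    push_cast at hm
    by_cases hl : b (d - 1) = b d
    · exact ih (d - 1) (by omega) (by omega)
    by_cases hr : b (d + 1) = b d + 1
    · exact ih (d + 1) (by omega) (by omega)
    · exact ⟨d, ⟨by omega, by omega⟩, hd⟩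

end Paths

/-! ### Deodhar's recursion on lattice paths. -/

section Recursion

open Classical in
/-- Deodhar's recursion of type `-1` at the diagonal `d`. -/
noncomputable def deodharOp (d : ℤ) (f : (ℤ → ℤ) → ℤ[X]) (c : ℤ → ℤ) : ℤ[X] :=
  if Removable d c then f (toggle d c)
  else if Addable d c then (Polynomial.X - 1) * f c + Polynomial.X * f (toggle d c)
  else Polynomial.X * f c

theorem deodharOp_of_removable {d : ℤ} {c : ℤ → ℤ} (h : Removable d c) (f : (ℤ → ℤ) → ℤ[X]) :
    deodharOp d f c = f (toggle d c) := by
  simp [deodharOp, h]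

theorem deodharOp_of_addable {d : ℤ} {c : ℤ → ℤ} (h : Addable d c) (f : (ℤ → ℤ) → ℤ[X]) :
    deodharOp d f c = (Polynomial.X - 1) * f c + Polynomial.X * f (toggle d c) := by
  simp [deodharOp, h, h.not_removable]

theorem deodharOp_of_not {d : ℤ} {c : ℤ → ℤ} (h : ¬ Removable d c) (h' : ¬ Addable d c)
    (f : (ℤ → ℤ) → ℤ[X]) : deodharOp d f c = Polynomial.X * f c := by
  simp [deodharOp, h, h']

theorem farComm_deodharOp : FarComm deodharOp := by
  intro d e h f
  have h' : 2 ≤ |e - d| := by rwa [abs_sub_comm]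
  funext c
  have r1 := removable_toggle_iff h c
  have r2 := removable_toggle_iff h' c
  have a1 := addable_toggle_iff h c
  have a2 := addable_toggle_iff h' c
  have hcomm := toggle_comm h c
  by_cases hd : Removable d c <;> by_cases he : Removable e c <;> by_cases hd' : Addable d c <;>
    by_cases he' : Addable e c <;> simp [deodharOp, r1, r2, a1, a2, hd, he, hd', he', hcomm] <;> ring

open Classical in
/-- The recursion at the ground path. -/
noncomputable def groundR (c : ℤ → ℤ) : ℤ[X] := if c = ground then 1 else 0

open Classical in
/-- The relative `R`-polynomials in terms of lattice paths; the first argument is the path of the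
larger element. -/
noncomputable def pathR (b : ℤ → ℤ) : (ℤ → ℤ) → ℤ[X] :=
  if h : ∃ f, Builds deodharOp groundR b f then h.choose else 0

theorem builds_pathR {b : ℤ → ℤ} {k : ℕ} (h : HasSize b k) :
    Builds deodharOp groundR b (pathR b) := by
  have h' := h.exists_builds deodharOp groundR
  rw [pathR, dif_pos h']
  exact h'.choose_spec

/-- The recursion is valid at every corner, whichever order of building was chosen: this is where
the commutation of the operators enters. -/
theorem pathR_of_removable {b : ℤ → ℤ} {k : ℕ} (h : HasSize b k) {d : ℤ} (hd : Removable d b) :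
    pathR b = deodharOp d (pathR (toggle d b)) := by
  obtain ⟨z, hz, hk⟩ := h.exists_of_removable farComm_succ hd
  have h1 := (builds_pathR hz).add d hd.addable_toggle
  rw [toggle_toggle] at h1
  exact (builds_pathR h).unique farComm_deodharOp h1

/-- A toggle raises `c` by at most 1, and that of `b` raises it by exactly 1. Containment is thereby
preserved when a letter is put in front of a subword. -/
theorem toggle_le_toggle_of_addable {d : ℤ} {b c : ℤ → ℤ} (hc : IsPath c) (hle : c ≤ b)
    (hb : Addable d b) : toggle d c ≤ toggle d b := by
  intro x
  by_cases hx : x = d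
  · subst hx
    have h1 : c x ≤ b x := hle x
    have h2 : c (x - 1) ≤ b (x - 1) := hle _
    have h3 : c (x + 1) ≤ b (x + 1) := hle _
    have h4 := hc x
    have h5 := hc.left x
    have h6 := hb.1
    have h7 := hb.2
    rw [toggle_self, toggle_self]
    exact (show c (x - 1) + c (x + 1) - c x ≤ b (x - 1) + b (x + 1) - b x by omega)
  · rw [toggle_of_ne _ hx, toggle_of_ne _ hx]; exact hle x

theorem Builds.eq_zero_of_not_le {b : ℤ → ℤ} {f : (ℤ → ℤ) → ℤ[X]}
    (h : Builds deodharOp groundR b f) : ∀ {c : ℤ → ℤ}, ¬ c ≤ b → f c = 0 := by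
  induction h with
  | ground =>
    intro c hc
    exact if_neg fun h => hc h.le
  | @add b f d h hadd ih =>
    intro c hc
    have h1 : ¬ c ≤ b := fun h => hc (h.trans (le_toggle_of_addable hadd))
    -- Every value of `f` that the operator uses is at a path not below `b`; the toggled path is
    -- used only when a box can be removed or added.
    have h2 : ¬ toggle d c ≤ b ∨ ¬ Removable d c ∧ ¬ Addable d c := by
      by_cases hr : Removable d c
      · refine Or.inl fun hle => hc fun x => ?_
        by_cases hx : x = d
        · subst hx
          have : toggle x c x ≤ b x := hle x
          rw [hr.toggle_self] at this
          rw [hadd.toggle_self]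
          exact (show c x ≤ b x + 1 by omega)
        · have : toggle d c x ≤ b x := hle x
          rw [toggle_of_ne _ hx] at this ⊢
          exact this
      by_cases ha : Addable d c
      · exact Or.inl fun hle => h1 ((le_toggle_of_addable ha).trans hle)
      · exact Or.inr ⟨hr, ha⟩
    rcases h2 with h2 | h2
    · simp [deodharOp, ih h1, ih h2]
    · simp [deodharOp, h2, ih h1]

theorem Builds.eq_one {b : ℤ → ℤ} {f : (ℤ → ℤ) → ℤ[X]}
    (h : Builds deodharOp groundR b f) : f b = 1 := by
  induction h with
  | ground => exact if_pos rfl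
  | add d _ hadd ih => rw [deodharOp_of_removable hadd.removable_toggle, toggle_toggle, ih]

theorem pathR_eq_zero {b : ℤ → ℤ} {k : ℕ} (h : HasSize b k) {c : ℤ → ℤ} (hc : ¬ c ≤ b) :
    pathR b c = 0 :=
  (builds_pathR h).eq_zero_of_not_le hc

theorem pathR_self {b : ℤ → ℤ} {k : ℕ} (h : HasSize b k) : pathR b b = 1 :=
  (builds_pathR h).eq_one

end Recursion

/-! ### Translation invariance of the path recursion. -/

section Translation

/-- The skew diagram between `c` and `b`, translated by `δ` diagonals and `τ` rows, is the one
between `c'` and `b'`. -/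
def SkewTranslate (δ τ : ℤ) (b c b' c' : ℤ → ℤ) : Prop :=
  ∀ d, (b d = c d ∧ b' (d + δ) = c' (d + δ)) ∨
    (b' (d + δ) = b d + τ ∧ c' (d + δ) = c d + τ)

theorem SkewTranslate.symm {δ τ : ℤ} {b c b' c' : ℤ → ℤ} (h : SkewTranslate δ τ b c b' c') :
    SkewTranslate (-δ) (-τ) b' c' b c := by
  intro d
  have := h (d + -δ)
  rw [show d + -δ + δ = d by ring] at this
  omega

/-- The conditions of a skew translation at the two neighbours of a diagonal. -/
theorem SkewTranslate.at_neighbours {δ τ : ℤ} {b c b' c' : ℤ → ℤ}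
    (h : SkewTranslate δ τ b c b' c') (d : ℤ) :
    ((b (d - 1) = c (d - 1) ∧ b' (d + δ - 1) = c' (d + δ - 1)) ∨
      (b' (d + δ - 1) = b (d - 1) + τ ∧ c' (d + δ - 1) = c (d - 1) + τ)) ∧
    ((b (d + 1) = c (d + 1) ∧ b' (d + δ + 1) = c' (d + δ + 1)) ∨
      (b' (d + δ + 1) = b (d + 1) + τ ∧ c' (d + δ + 1) = c (d + 1) + τ)) := by
  have h1 := h (d - 1)
  have h2 := h (d + 1)
  rw [show d - 1 + δ = d + δ - 1 by ring] at h1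
  rw [show d + 1 + δ = d + δ + 1 by ring] at h2
  exact ⟨h1, h2⟩

/-- On a nonempty neighbouring diagonal the values are translated. An empty one forces `c d = b d -
1`, and then `b'`, which meets `c'` there, has its step forced by the path conditions on both. -/
theorem SkewTranslate.removable_upper {δ τ : ℤ} {b c b' c' : ℤ → ℤ}
    (h : SkewTranslate δ τ b c b' c') (hb' : IsPath b') (hc : IsPath c)
    (hc' : IsPath c') {d : ℤ} (hlt : c d < b d) (hr : Removable d b) : Removable (d + δ) b' := by
  obtain ⟨h1, h2⟩ := h.at_neighbours d
  have h0 := h d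
  have a1 := hb' (d + δ)
  have a2 := hb'.left (d + δ)
  have a3 := hc d
  have a4 := hc.left d
  have a5 := hc' (d + δ)
  have a6 := hc'.left (d + δ)
  obtain ⟨r1, r2⟩ := hr
  exact ⟨by omega, by omega⟩

/-- Both paths have the same two steps at `d` but different heights, so neither neighbouring
diagonal is empty and the lower path is translated around `d`. -/
theorem SkewTranslate.removable_lower {δ τ : ℤ} {b c b' c' : ℤ → ℤ}
    (h : SkewTranslate δ τ b c b' c') {d : ℤ} (hlt : c d < b d) (hr : Removable d b)
    (hrc : Removable d c) : Removable (d + δ) c' := by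
  obtain ⟨h1, h2⟩ := h.at_neighbours d
  have h0 := h d
  obtain ⟨r1, r2⟩ := hr
  obtain ⟨s1, s2⟩ := hrc
  exact ⟨by omega, by omega⟩

/-- At an empty neighbouring diagonal the lower path is not controlled by translation; its value
there is that of the upper path, known from the corner of `b'`. -/
theorem SkewTranslate.addable_lower {δ τ : ℤ} {b c b' c' : ℤ → ℤ}
    (h : SkewTranslate δ τ b c b' c') {d : ℤ} (hlt : c d < b d) (hr : Removable d b)
    (hr' : Removable (d + δ) b') (hac : Addable d c) : Addable (d + δ) c' := by
  obtain ⟨h1, h2⟩ := h.at_neighbours d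
  have h0 := h d
  obtain ⟨r1, r2⟩ := hr
  obtain ⟨t1, t2⟩ := hr'
  obtain ⟨s1, s2⟩ := hac
  exact ⟨by omega, by omega⟩

/-- Changing the paths at one diagonal keeps a skew translation if it does so there. -/
theorem SkewTranslate.congr_of_ne {δ τ : ℤ} {b c b' c' f g f' g' : ℤ → ℤ}
    (h : SkewTranslate δ τ b c b' c') (d : ℤ)
    (hf : ∀ x, x ≠ d → f x = b x) (hg : ∀ x, x ≠ d → g x = c x)
    (hf' : ∀ x, x ≠ d + δ → f' x = b' x) (hg' : ∀ x, x ≠ d + δ → g' x = c' x)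
    (hd : (f d = g d ∧ f' (d + δ) = g' (d + δ)) ∨
      (f' (d + δ) = f d + τ ∧ g' (d + δ) = g d + τ)) :
    SkewTranslate δ τ f g f' g' := by
  intro x
  by_cases hx : x = d
  · subst hx; exact hd
  · have hx' : x + δ ≠ d + δ := fun e => hx (by omega)
    rw [hf x hx, hg x hx, hf' _ hx', hg' _ hx']
    exact h x

theorem le_of_eq_of_ne {b c f g : ℤ → ℤ} (h : c ≤ b) (d : ℤ) (hf : ∀ x, x ≠ d → f x = b x)
    (hg : ∀ x, x ≠ d → g x = c x) (hd : g d ≤ f d) : g ≤ f := by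
  intro x
  by_cases hx : x = d
  · subst hx; exact hd
  · rw [hf x hx, hg x hx]; exact h x

theorem removable_of_eq {b c : ℤ → ℤ} (hc : IsPath c) (hle : c ≤ b) {d : ℤ}
    (hr : Removable d b) (he : b d = c d) : Removable d c := by
  have h1 : c (d - 1) ≤ b (d - 1) := hle _
  have h2 : c (d + 1) ≤ b (d + 1) := hle _
  have h3 := hc d
  have h4 := hc.left d
  obtain ⟨r1, r2⟩ := hr
  exact ⟨by omega, by omega⟩

/-- The path form of the invariance of relative `R`-polynomials under translations of the skew
diagram. -/
theorem pathR_eq_of_skewTranslate {δ τ : ℤ} : ∀ (m : ℕ) {b c b' c' : ℤ → ℤ} {k k' l l' : ℕ},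
    HasSize b k → HasSize b' k' → HasSize c l → HasSize c' l' → k + k' = m → c ≤ b → c' ≤ b' →
    SkewTranslate δ τ b c b' c' → pathR b c = pathR b' c' := by
  intro m
  induction m using Nat.strong_induction_on with
  | _ m ih =>
  intro b c b' c' k k' l l' hb hb' hc hc' hm hle hle' hs
  by_cases hbc : ∃ d, c d < b d
  swap
  · have h1 : b = c := by
      funext d
      exact le_antisymm (not_lt.mp fun h => hbc ⟨d, h⟩) (hle d)
    have h2 : b' = c' := by
      funext d
      have := hs (d - δ)
      rw [sub_add_cancel, h1] at this
      omega
    rw [h1, h2, pathR_self hc, pathR_self hc']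
  -- A corner outside the skew diagram is a corner of both diagrams; removing it from both changes
  -- neither the skew diagram nor the polynomial.
  by_cases he : ∃ d, Removable d b ∧ b d = c d
  · obtain ⟨d, hr, he⟩ := he
    have hrc := removable_of_eq hc.isPath hle hr he
    obtain ⟨z, hz, rfl⟩ := hb.exists_of_removable farComm_succ hr
    obtain ⟨y, hy, rfl⟩ := hc.exists_of_removable farComm_succ hrc
    rw [pathR_of_removable hb hr, deodharOp_of_removable hrc]
    refine ih (z + k') (by omega) hz hb' hy hc' rfl ?_ hle' ?_
    · refine le_of_eq_of_ne hle d (fun x => toggle_of_ne b) (fun x => toggle_of_ne c) ?_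
      rw [hr.toggle_self, hrc.toggle_self, he]
    · have h0 := hs d
      refine hs.congr_of_ne d (fun x => toggle_of_ne b) (fun x => toggle_of_ne c)
        (fun _ _ => rfl) (fun _ _ => rfl) (Or.inl ?_)
      rw [hr.toggle_self, hrc.toggle_self, he]
      exact ⟨rfl, by omega⟩
  by_cases he' : ∃ d, Removable d b' ∧ b' d = c' d
  · obtain ⟨d, hr, he⟩ := he'
    have hrc := removable_of_eq hc'.isPath hle' hr he
    obtain ⟨z, hz, rfl⟩ := hb'.exists_of_removable farComm_succ hr
    obtain ⟨y, hy, rfl⟩ := hc'.exists_of_removable farComm_succ hrc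
    rw [pathR_of_removable hb' hr, deodharOp_of_removable hrc]
    refine ih (k + z) (by omega) hb hz hc hy rfl hle ?_ ?_
    · refine le_of_eq_of_ne hle' d (fun x => toggle_of_ne b') (fun x => toggle_of_ne c') ?_
      rw [hr.toggle_self, hrc.toggle_self, he]
    · have h0 := hs (d - δ)
      rw [sub_add_cancel] at h0
      refine hs.congr_of_ne (d - δ) (fun _ _ => rfl) (fun _ _ => rfl)
        (fun x hx => toggle_of_ne b' (by rwa [sub_add_cancel] at hx))
        (fun x hx => toggle_of_ne c' (by rwa [sub_add_cancel] at hx)) (Or.inl ?_)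
      rw [sub_add_cancel, hr.toggle_self, hrc.toggle_self, he]
      exact ⟨by omega, rfl⟩
  obtain ⟨d₀, hd₀⟩ := hbc
  obtain ⟨d, hr, hlt⟩ := hb.exists_removable_of_lt hc.isPath hc.ground_le hd₀
  have hr' := hs.removable_upper hb'.isPath hc.isPath hc'.isPath hlt hr
  have h0 := hs d
  have hlt' : c' (d + δ) < b' (d + δ) := by omega
  have hs' : SkewTranslate (-δ) (-τ) b' c' b c := hs.symm
  have hdd : d + δ + -δ = d := by ring
  obtain ⟨z, hz, rfl⟩ := hb.exists_of_removable farComm_succ hr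
  obtain ⟨z', hz', rfl⟩ := hb'.exists_of_removable farComm_succ hr'
  have hsz : z + z' < m := by omega
  have hle1 : c ≤ toggle d b := by
    refine le_of_eq_of_ne hle d (fun x => toggle_of_ne b) (fun _ _ => rfl) ?_
    rw [hr.toggle_self]; omega
  have hle1' : c' ≤ toggle (d + δ) b' := by
    refine le_of_eq_of_ne hle' (d + δ) (fun x => toggle_of_ne b') (fun _ _ => rfl) ?_
    rw [hr'.toggle_self]; omega
  have hs1 : SkewTranslate δ τ (toggle d b) c (toggle (d + δ) b') c' := by
    refine hs.congr_of_ne d (fun x => toggle_of_ne b) (fun _ _ => rfl)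
      (fun x => toggle_of_ne b') (fun _ _ => rfl) (Or.inr ?_)
    rw [hr.toggle_self, hr'.toggle_self]
    omega
  have ih1 : pathR (toggle d b) c = pathR (toggle (d + δ) b') c' :=
    ih _ hsz hz hz' hc hc' rfl hle1 hle1' hs1
  rw [pathR_of_removable hb hr, pathR_of_removable hb' hr']
  by_cases hrc : Removable d c
  · have hrc' := hs.removable_lower hlt hr hrc
    obtain ⟨y, hy, rfl⟩ := hc.exists_of_removable farComm_succ hrc
    obtain ⟨y', hy', rfl⟩ := hc'.exists_of_removable farComm_succ hrc'
    rw [deodharOp_of_removable hrc, deodharOp_of_removable hrc']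
    refine ih _ hsz hz hz' hy hy' rfl ?_ ?_ ?_
    · refine le_of_eq_of_ne hle d (fun x => toggle_of_ne b) (fun x => toggle_of_ne c) ?_
      rw [hr.toggle_self, hrc.toggle_self]; omega
    · refine le_of_eq_of_ne hle' (d + δ) (fun x => toggle_of_ne b') (fun x => toggle_of_ne c') ?_
      rw [hr'.toggle_self, hrc'.toggle_self]; omega
    · refine hs.congr_of_ne d (fun x => toggle_of_ne b) (fun x => toggle_of_ne c)
        (fun x => toggle_of_ne b') (fun x => toggle_of_ne c') (Or.inr ?_)
      rw [hr.toggle_self, hr'.toggle_self, hrc.toggle_self, hrc'.toggle_self]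
      omega
  have hrc' : ¬ Removable (d + δ) c' := fun h => hrc (hdd ▸ hs'.removable_lower hlt' hr' h)
  by_cases hac : Addable d c
  · have hac' := hs.addable_lower hlt hr hr' hac
    rw [deodharOp_of_addable hac, deodharOp_of_addable hac', ih1]
    congr 2
    have hy := hc.add d hac
    have hy' := hc'.add (d + δ) hac'
    -- With at least two skew boxes on the diagonal, one can be lost at each end. With a single one
    -- the modified paths cross, on both sides of the translation, and both terms vanish.
    by_cases hcase : c d + 1 ≤ b d - 1
    · refine ih _ hsz hz hz' hy hy' rfl ?_ ?_ ?_
      · refine le_of_eq_of_ne hle d (fun x => toggle_of_ne b) (fun x => toggle_of_ne c) ?_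
        rw [hr.toggle_self, hac.toggle_self]; omega
      · refine le_of_eq_of_ne hle' (d + δ) (fun x => toggle_of_ne b')
          (fun x => toggle_of_ne c') ?_
        rw [hr'.toggle_self, hac'.toggle_self]; omega
      · refine hs.congr_of_ne d (fun x => toggle_of_ne b) (fun x => toggle_of_ne c)
          (fun x => toggle_of_ne b') (fun x => toggle_of_ne c') (Or.inr ?_)
        rw [hr.toggle_self, hr'.toggle_self, hac.toggle_self, hac'.toggle_self]
        omega
    · rw [pathR_eq_zero hz, pathR_eq_zero hz']
      · intro h
        have : toggle (d + δ) c' (d + δ) ≤ toggle (d + δ) b' (d + δ) := h _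
        rw [hr'.toggle_self, hac'.toggle_self] at this
        omega
      · intro h
        have : toggle d c d ≤ toggle d b d := h _
        rw [hr.toggle_self, hac.toggle_self] at this
        omega
  have hac' : ¬ Addable (d + δ) c' := fun h =>
    hac (hdd ▸ hs'.addable_lower hlt' hr' (hdd.symm ▸ hr) h)
  rw [deodharOp_of_not hrc hac, deodharOp_of_not hrc' hac', ih1]

end Translation

/-! ### The action of the Coxeter group of type `A` on lattice paths. -/

section PathAction

variable {n : ℕ} {W : Type*} [Group W]

/-- The diagonal of the boxes with label `i`. -/
def diag (p i : Fin n) : ℤ := (i : ℤ) - p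

theorem diag_injective (p : Fin n) : Function.Injective (diag p) := by
  intro i j h
  simp only [diag] at h
  exact Fin.ext (by omega)

/-- In terms of steps this is the braid relation for adjacent transpositions. -/
theorem toggle_braid (d : ℤ) (b : ℤ → ℤ) :
    toggle d (toggle (d + 1) (toggle d b)) = toggle (d + 1) (toggle d (toggle (d + 1) b)) := by
  funext x
  simp only [toggle_apply]
  grind

theorem toggle_braid' {d e : ℤ} (h : e = d + 1 ∨ d = e + 1) (b : ℤ → ℤ) :
    toggle d (toggle e (toggle d b)) = toggle e (toggle d (toggle e b)) := by
  rcases h with rfl | rfl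
  · exact toggle_braid d b
  · exact (toggle_braid e b).symm

/-- The action of a simple reflection on lattice paths. -/
def toggleEnd (p i : Fin n) : Function.End (ℤ → ℤ) := toggle (diag p i)

theorem isLiftable_toggleEnd (p : Fin n) :
    (CoxeterMatrix.A n).IsLiftable (toggleEnd p) := by
  intro i j
  have hM : (CoxeterMatrix.A n).M i j =
    if i = j then 1 else (if (j : ℕ) + 1 = i ∨ (i : ℕ) + 1 = j then 3 else 2) := rfl
  rw [hM]
  funext b
  split_ifs with h1 h2
  · subst h1
    exact toggle_toggle _ b
  · change toggle (diag p i) (toggle (diag p j) (toggle (diag p i) (toggle (diag p j)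
      (toggle (diag p i) (toggle (diag p j) b))))) = b
    have hd : diag p j = diag p i + 1 ∨ diag p i = diag p j + 1 := by simp only [diag]; omega
    rw [← toggle_braid' hd, toggle_toggle, toggle_toggle, toggle_toggle]
  · have hij : (i : ℕ) ≠ j := fun h => h1 (Fin.ext h)
    have hd : 2 ≤ |diag p i - diag p j| := by
      rw [le_abs]; simp only [diag]; omega
    change toggle (diag p i) (toggle (diag p j) (toggle (diag p i) (toggle (diag p j) b))) = b
    rw [toggle_comm hd, toggle_toggle, toggle_toggle]

/-- The action of the Coxeter group of type `A` on lattice paths. -/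
def pathAct (cs : CoxeterSystem (CoxeterMatrix.A n) W) (p : Fin n) :
    W →* Function.End (ℤ → ℤ) :=
  cs.lift ⟨toggleEnd p, isLiftable_toggleEnd p⟩

theorem pathAct_simple (cs : CoxeterSystem (CoxeterMatrix.A n) W) (p i : Fin n) (b : ℤ → ℤ) :
    pathAct cs p (cs.simple i) b = toggle (diag p i) b := by
  rw [pathAct, cs.lift_apply_simple, toggleEnd]

theorem pathAct_mul (cs : CoxeterSystem (CoxeterMatrix.A n) W) (p : Fin n) (v w : W)
    (b : ℤ → ℤ) : pathAct cs p (v * w) b = pathAct cs p v (pathAct cs p w b) := by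
  rw [map_mul]; rfl

/-- The lattice path of the coset of `w`. -/
def pathOf (cs : CoxeterSystem (CoxeterMatrix.A n) W) (p : Fin n) (w : W) : ℤ → ℤ :=
  pathAct cs p w ground

variable {cs : CoxeterSystem (CoxeterMatrix.A n) W} {p : Fin n}

theorem pathOf_one : pathOf cs p 1 = ground := by rw [pathOf, map_one]; rfl

theorem pathOf_simple_mul (i : Fin n) (w : W) :
    pathOf cs p (cs.simple i * w) = toggle (diag p i) (pathOf cs p w) := by
  rw [pathOf, pathAct_mul, pathAct_simple, pathOf]

theorem not_addable_ground {d : ℤ} (h : d ≠ 0) : ¬ Addable d ground := by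
  simp only [Addable, ground]
  omega

/-- The ground path turns only at the diagonal 0, so the generators of `W_J` fix it. -/
theorem pathOf_mul_simple (w : W) {j : Fin n} (hj : j ≠ p) :
    pathOf cs p (w * cs.simple j) = pathOf cs p w := by
  have hd : diag p j ≠ 0 := fun h => hj (Fin.ext (by simp only [diag] at h; omega))
  rw [pathOf, pathAct_mul, pathAct_simple,
    isPath_ground.toggle_eq_self (not_addable_ground hd) (not_removable_ground _), pathOf]

theorem pathOf_mul_wordProd (w : W) {l : List (Fin n)} (hl : ∀ j ∈ l, j ≠ p) :
    pathOf cs p (w * cs.wordProd l) = pathOf cs p w := by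
  induction l generalizing w with
  | nil => simp
  | cons j l ih =>
    rw [cs.wordProd_cons, ← mul_assoc, ih _ fun k hk => hl k (List.mem_cons_of_mem _ hk),
      pathOf_mul_simple _ (hl j List.mem_cons_self)]

theorem exists_hasSize_pathOf_wordProd (l : List (Fin n)) :
    ∃ k ≤ l.length, HasSize (pathOf cs p (cs.wordProd l)) k := by
  induction l with
  | nil => exact ⟨0, le_rfl, by rw [cs.wordProd_nil, pathOf_one]; exact .ground⟩
  | cons i l ih =>
    obtain ⟨k, hk, hs⟩ := ih
    obtain ⟨m, hm, hs'⟩ := hs.toggle (diag p i)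
    rw [cs.wordProd_cons, pathOf_simple_mul]
    exact ⟨m, by simp; omega, hs'⟩

theorem HasSize.le_length_word {l : List (Fin n)} {k : ℕ}
    (h : HasSize (pathOf cs p (cs.wordProd l)) k) : k ≤ l.length := by
  obtain ⟨m, hm, hs⟩ := exists_hasSize_pathOf_wordProd (cs := cs) (p := p) l
  rwa [h.unique farComm_succ hs]

theorem HasSize.le_length {w : W} {k : ℕ} (h : HasSize (pathOf cs p w) k) :
    k ≤ cs.length w := by
  obtain ⟨l, hl, rfl⟩ := cs.exists_isReduced w
  exact h.le_length_word.trans hl.symm.le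

theorem exists_hasSize_pathOf (cs : CoxeterSystem (CoxeterMatrix.A n) W) (p : Fin n) (w : W) :
    ∃ k, HasSize (pathOf cs p w) k := by
  obtain ⟨l, rfl⟩ := cs.wordProd_surjective w
  obtain ⟨k, _, hk⟩ := exists_hasSize_pathOf_wordProd (cs := cs) (p := p) l
  exact ⟨k, hk⟩

theorem isPath_pathOf (w : W) : IsPath (pathOf cs p w) :=
  (exists_hasSize_pathOf cs p w).choose_spec.isPath

/-- The path of a diagram in the rectangle. -/
def InRectangle (p : Fin n) (b : ℤ → ℤ) : Prop :=
  ∀ d : ℤ, d < -(p : ℤ) ∨ (n : ℤ) - p ≤ d → b d = ground d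

theorem InRectangle.exists_diag {b : ℤ → ℤ} (h : InRectangle p b) {d : ℤ} (hd : Removable d b) :
    ∃ i : Fin n, d = diag p i := by
  have hp := p.isLt
  by_cases hr : d < -(p : ℤ) ∨ (n : ℤ) - p ≤ d
  · obtain ⟨h1, h2⟩ := hd
    have h0 := h d hr
    simp only [ground] at h0
    rcases hr with hr | hr
    · have h3 := h (d - 1) (Or.inl (by omega))
      simp only [ground] at h3
      omega
    · have h3 := h (d + 1) (Or.inr (by omega))
      simp only [ground] at h3
      omega
  · exact ⟨⟨(d + p).toNat, by omega⟩, by simp only [diag]; omega⟩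

theorem InRectangle.toggle {b : ℤ → ℤ} (h : InRectangle p b) (i : Fin n) :
    InRectangle p (toggle (diag p i) b) := by
  intro d hd
  have hi := i.isLt
  rw [toggle_of_ne _ (by simp only [diag]; omega)]
  exact h d hd

theorem inRectangle_pathOf (cs : CoxeterSystem (CoxeterMatrix.A n) W) (p : Fin n) (w : W) :
    InRectangle p (pathOf cs p w) := by
  induction w using cs.simple_induction_left with
  | one => rw [pathOf_one]; exact fun _ _ => rfl
  | mul_simple_left w i ih => rw [pathOf_simple_mul]; exact ih.toggle i

theorem simple_mul_simple_comm (cs : CoxeterSystem (CoxeterMatrix.A n) W) {i j : Fin n}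
    (h : 2 ≤ |diag p i - diag p j|) : cs.simple i * cs.simple j = cs.simple j * cs.simple i := by
  have h' : 2 ≤ (i : ℤ) - j ∨ 2 ≤ (j : ℤ) - i := by
    simp only [diag] at h
    rcases le_abs.mp h with h | h <;> omega
  have hM : (CoxeterMatrix.A n).M i j = 2 := by
    change (if i = j then 1 else (if (j : ℕ) + 1 = i ∨ (i : ℕ) + 1 = j then 3 else 2)) = 2
    rw [if_neg (by rintro rfl; omega), if_neg (by omega)]
  have h2 := cs.simple_mul_simple_pow i j
  rw [hM, pow_two] at h2
  have h3 := eq_inv_of_mul_eq_one_left h2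
  rwa [mul_inv_rev, cs.inv_simple, cs.inv_simple] at h3

theorem simple_braid (cs : CoxeterSystem (CoxeterMatrix.A n) W) {i j : Fin n}
    (h : diag p j = diag p i + 1 ∨ diag p i = diag p j + 1) :
    cs.simple i * (cs.simple j * cs.simple i) = cs.simple j * (cs.simple i * cs.simple j) := by
  have hM : (CoxeterMatrix.A n).M i j = 3 := by
    simp only [diag] at h
    change (if i = j then 1 else (if (j : ℕ) + 1 = i ∨ (i : ℕ) + 1 = j then 3 else 2)) = 3
    rw [if_neg (by rintro rfl; omega), if_pos (by omega)]
  have h2 := cs.simple_mul_simple_pow i j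
  rw [hM] at h2
  have h3 : (cs.simple i * (cs.simple j * cs.simple i)) *
      (cs.simple j * (cs.simple i * cs.simple j)) = 1 := by
    rw [← h2]; simp only [pow_succ, pow_zero, one_mul, mul_assoc]
  have h4 := eq_inv_of_mul_eq_one_left h3
  simpa only [mul_inv_rev, cs.inv_simple, mul_assoc] using h4

/-! ### Diagrams as minimal coset representatives. -/

open Classical in
/-- Left multiplication by the simple reflection of the diagonal `d`, if there is one. -/
noncomputable def diagMul (cs : CoxeterSystem (CoxeterMatrix.A n) W) (p : Fin n) (d : ℤ) (w : W) :
    W :=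
  if h : ∃ i, diag p i = d then cs.simple h.choose * w else w

theorem diagMul_diag (i : Fin n) (w : W) : diagMul cs p (diag p i) w = cs.simple i * w := by
  have h : ∃ j, diag p j = diag p i := ⟨i, rfl⟩
  rw [diagMul, dif_pos h, diag_injective p h.choose_spec]

theorem farComm_diagMul : FarComm (diagMul cs p) := by
  intro d e hde w
  by_cases hd : ∃ i, diag p i = d
  · obtain ⟨i, rfl⟩ := hd
    by_cases he : ∃ j, diag p j = e
    · obtain ⟨j, rfl⟩ := he
      simp only [diagMul_diag, ← mul_assoc, simple_mul_simple_comm cs hde]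
    · simp [diagMul, he]
  · simp [diagMul, hd]

/-- `w` is the product of the labels of the boxes of the diagram with path `b`. -/
abbrev IsRep (cs : CoxeterSystem (CoxeterMatrix.A n) W) (p : Fin n) (b : ℤ → ℤ) (w : W) : Prop :=
  Builds (diagMul cs p) 1 b w

theorem IsRep.add_simple {b : ℤ → ℤ} {w : W} (h : IsRep cs p b w) {i : Fin n}
    (ha : Addable (diag p i) b) : IsRep cs p (toggle (diag p i) b) (cs.simple i * w) := by
  rw [← diagMul_diag (p := p)]
  exact h.add _ ha

theorem IsRep.remove_simple {b : ℤ → ℤ} {w : W} (h : IsRep cs p b w) {i : Fin n}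
    (hr : Removable (diag p i) b) : IsRep cs p (toggle (diag p i) b) (cs.simple i * w) := by
  obtain ⟨z, hz, rfl⟩ := h.exists_of_removable farComm_diagMul hr
  rwa [diagMul_diag, cs.simple_mul_simple_cancel_left]

theorem IsRep.exists_removable {b : ℤ → ℤ} {w : W} (h : IsRep cs p b w) (hb : InRectangle p b) :
    (b = ground ∧ w = 1) ∨ ∃ i, Removable (diag p i) b := by
  rcases h with _ | ⟨d, h, hadd⟩
  · exact Or.inl ⟨rfl, rfl⟩
  · obtain ⟨i, rfl⟩ := hb.exists_diag hadd.removable_toggle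
    exact Or.inr ⟨i, hadd.removable_toggle⟩

/-- The word reads one letter per box. Its length serves to compute `ℓ(w)`, and the clause on
subwords turns Bruhat order into containment. -/
theorem IsRep.exists_word {k : ℕ} : ∀ {b : ℤ → ℤ} {w : W}, IsRep cs p b w → InRectangle p b →
    HasSize b k → pathOf cs p w = b ∧ ∃ l : List (Fin n), cs.wordProd l = w ∧ l.length = k ∧
      ∀ l' : List (Fin n), l'.Sublist l → pathOf cs p (cs.wordProd l') ≤ b := by
  induction k with
  | zero =>
    intro b w h hb hk
    rcases h.exists_removable hb with ⟨rfl, rfl⟩ | ⟨i, hi⟩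
    · refine ⟨pathOf_one, [], cs.wordProd_nil, rfl, fun l' hl' => ?_⟩
      rw [List.sublist_nil.mp hl', cs.wordProd_nil, pathOf_one]
    · obtain ⟨z, _, hz⟩ := hk.exists_of_removable farComm_succ hi
      omega
  | succ k ih =>
    intro b w h hb hk
    rcases h.exists_removable hb with ⟨rfl, rfl⟩ | ⟨i, hi⟩
    · exact absurd (hk.unique farComm_succ .ground) (Nat.succ_ne_zero k)
    · obtain ⟨z, hz, hzk⟩ := hk.exists_of_removable farComm_succ hi
      obtain rfl : k = z := by omega
      obtain ⟨h1, l, h2, h3, h4⟩ := ih (h.remove_simple hi) (hb.toggle i) hz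
      have hw : w = cs.simple i * (cs.simple i * w) := by rw [cs.simple_mul_simple_cancel_left]
      have hle : toggle (diag p i) b ≤ b := by
        have := le_toggle_of_addable hi.addable_toggle
        rwa [toggle_toggle] at this
      refine ⟨by rw [hw, pathOf_simple_mul, h1, toggle_toggle], i :: l, ?_, by simp [h3], ?_⟩
      · rw [cs.wordProd_cons, h2, ← hw]
      · intro l' hl'
        rcases List.sublist_cons_iff.mp hl' with hl' | ⟨r, rfl, hr⟩
        · exact (h4 l' hl').trans hle
        · rw [cs.wordProd_cons, pathOf_simple_mul]
          have := toggle_le_toggle_of_addable (isPath_pathOf _) (h4 r hr) hi.addable_toggle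
          rwa [toggle_toggle] at this

/-- The box word bounds the length above; below, each letter of any word creates at most one box. -/
theorem IsRep.length_eq {b : ℤ → ℤ} {w : W} (h : IsRep cs p b w) (hb : InRectangle p b) {k : ℕ}
    (hk : HasSize b k) : cs.length w = k := by
  obtain ⟨h1, l, rfl, h3, _⟩ := h.exists_word hb hk
  refine le_antisymm (h3 ▸ cs.length_wordProd_le l) ?_
  rw [← h1] at hk
  exact hk.le_length

/-- A simple reflection that fixes the path of a representative can be moved to its right. -/
theorem IsRep.exists_simple_mul_eq {k : ℕ} : ∀ {b : ℤ → ℤ} {w : W} {i : Fin n}, IsRep cs p b w →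
    InRectangle p b → HasSize b k → ¬ Addable (diag p i) b → ¬ Removable (diag p i) b →
    ∃ j ≠ p, cs.simple i * w = w * cs.simple j := by
  induction k using Nat.strong_induction_on with
  | _ k ih =>
  intro b w i h hb hk ha hr
  rcases h.exists_removable hb with ⟨rfl, rfl⟩ | ⟨t, ht⟩
  · refine ⟨i, ?_, by simp⟩
    rintro rfl
    exact ha (by simp [Addable, ground, diag])
  have hti : t ≠ i := fun e => hr (e ▸ ht)
  obtain ⟨z, hz, rfl⟩ := hk.exists_of_removable farComm_succ ht
  have hrep := h.remove_simple ht
  have hw : w = cs.simple t * (cs.simple t * w) := by rw [cs.simple_mul_simple_cancel_left]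
  set b' := toggle (diag p t) b with hb'
  set w' := cs.simple t * w with hw'
  by_cases far : 2 ≤ |diag p i - diag p t|
  · obtain ⟨j, hj, he⟩ := ih z (by omega) hrep (hb.toggle t) hz
      (mt (addable_toggle_iff far b).mp ha) (mt (removable_toggle_iff far b).mp hr)
    refine ⟨j, hj, ?_⟩
    rw [hw, ← mul_assoc, simple_mul_simple_comm cs far, mul_assoc, he, ← mul_assoc]
  have hdiag : diag p t = diag p i + 1 ∨ diag p i = diag p t + 1 := by
    have hne : diag p t ≠ diag p i := fun e => hti (diag_injective p e)
    have := abs_lt.mp (not_le.mp far)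
    omega
  have hpath := h.isPath
  have p1 := hpath (diag p i)
  have p2 := hpath.left (diag p i)
  -- Removing the corner next to the straight place `i` creates a corner at `i`; once that is
  -- removed too, the path is straight at `t`. Induction moves `s_t` through what is left, and the
  -- braid relation turns `s_i s_t s_i` into `s_t s_i s_t`.
  have hr' : Removable (diag p i) b' := by
    simp only [Addable, Removable] at ha hr
    obtain ⟨t1, t2⟩ := ht
    rcases hdiag with e | e
    · rw [hb']
      simp only [Removable, toggle_apply, e, add_sub_cancel_right] at t1 t2 ⊢
      grind
    · rw [hb']
      simp only [Removable, toggle_apply, e, add_sub_cancel_right] at t1 t2 p1 p2 ha hr ⊢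
      grind
  have hrep2 := hrep.remove_simple hr'
  obtain ⟨y, hy, rfl⟩ := hz.exists_of_removable farComm_succ hr'
  have hpath2 := hrep2.isPath
  have q : ¬ Addable (diag p t) (toggle (diag p i) b') ∧
      ¬ Removable (diag p t) (toggle (diag p i) b') := by
    obtain ⟨t1, t2⟩ := ht
    obtain ⟨s1, s2⟩ := hr'
    rcases hdiag with e | e
    · rw [hb'] at s1 s2 ⊢
      simp only [Addable, Removable, toggle_apply, e, add_sub_cancel_right] at t1 t2 s1 s2 ⊢
      grind
    · rw [hb'] at s1 s2 ⊢
      simp only [Addable, Removable, toggle_apply, e, add_sub_cancel_right] at t1 t2 s1 s2 ⊢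
      grind
  obtain ⟨j, hj, he⟩ := ih y (by omega) hrep2 ((hb.toggle t).toggle i) hy q.1 q.2
  refine ⟨j, hj, ?_⟩
  have hw2 : w = cs.simple t * (cs.simple i * (cs.simple i * w')) := by
    rw [cs.simple_mul_simple_cancel_left, ← hw]
  have hbr := simple_braid cs hdiag
  calc cs.simple i * w
      = (cs.simple i * (cs.simple t * cs.simple i)) * (cs.simple i * w') := by
        rw [hw2]; simp only [mul_assoc, cs.simple_mul_simple_cancel_left]
    _ = cs.simple t * (cs.simple i * (cs.simple t * (cs.simple i * w'))) := by
        rw [hbr]; simp only [mul_assoc]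
    _ = w * cs.simple j := by rw [he, hw2]; simp only [mul_assoc]

/-- Every coset has a representative attached to its path. -/
theorem exists_isRep_mul_wordProd (cs : CoxeterSystem (CoxeterMatrix.A n) W) (p : Fin n) (w : W) :
    ∃ w₀, IsRep cs p (pathOf cs p w) w₀ ∧
      ∃ l : List (Fin n), (∀ j ∈ l, j ≠ p) ∧ w = w₀ * cs.wordProd l := by
  induction w using cs.simple_induction_left with
  | one => exact ⟨1, by rw [pathOf_one]; exact .ground, [], by simp, by simp⟩
  | mul_simple_left w i ih =>
    obtain ⟨w₀, hw₀, l, hl, he⟩ := ih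
    rw [pathOf_simple_mul]
    by_cases ha : Addable (diag p i) (pathOf cs p w)
    · exact ⟨_, hw₀.add_simple ha, l, hl, by rw [he, mul_assoc]⟩
    by_cases hr : Removable (diag p i) (pathOf cs p w)
    · exact ⟨_, hw₀.remove_simple hr, l, hl, by rw [he, mul_assoc]⟩
    rw [(isPath_pathOf w).toggle_eq_self ha hr]
    obtain ⟨k, hk⟩ := exists_hasSize_pathOf cs p w
    obtain ⟨j, hj, hij⟩ := hw₀.exists_simple_mul_eq (inRectangle_pathOf cs p w) hk ha hr
    refine ⟨w₀, hw₀, j :: l, ?_, ?_⟩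
    · intro x hx
      rcases List.mem_cons.mp hx with rfl | hx
      · exact hj
      · exact hl x hx
    · rw [he, cs.wordProd_cons, ← mul_assoc, hij, mul_assoc]

/-- Write `v` as the representative of its path times a shortest word in `W_J`. If that word ends in
`j`, minimality of `v` makes `v s_j` longer than `v`, and exchange deletes a letter from the word of
`v s_j` to give `v`. -/
theorem isRep_of_mem_minReps {v : W} (hv : v ∈ minReps cs (grassJ p)) :
    IsRep cs p (pathOf cs p v) v := by
  classical
  obtain ⟨w₀, hw₀, hex⟩ := exists_isRep_mul_wordProd cs p v
  obtain ⟨k, hk⟩ := exists_hasSize_pathOf cs p v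
  obtain ⟨_, L, rfl, hL, _⟩ := hw₀.exists_word (inRectangle_pathOf cs p v) hk
  have hP : ∃ m, ∃ l : List (Fin n), l.length = m ∧ (∀ j ∈ l, j ≠ p) ∧
      v = cs.wordProd L * cs.wordProd l := by
    obtain ⟨l, h1, h2⟩ := hex
    exact ⟨_, l, rfl, h1, h2⟩
  obtain ⟨l, hlen, hl, he⟩ := Nat.find_spec hP
  have hmin := fun m => Nat.find_min (m := m) hP
  rw [← hlen] at hmin
  rcases List.eq_nil_or_concat l with rfl | ⟨l₁, j, rfl⟩
  · rw [cs.wordProd_nil, mul_one] at he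
    rwa [← he] at hw₀
  exfalso
  rw [List.concat_eq_append] at *
  have hl₁ : ∀ x ∈ l₁, x ≠ p := fun x hx => hl x (List.mem_append_left _ hx)
  have hj : j ≠ p := hl j (by simp)
  have hz : cs.wordProd (L ++ l₁) * cs.simple j = v := by
    rw [he, cs.wordProd_append, cs.wordProd_append, cs.wordProd_singleton, mul_assoc]
  have hlt := hv j hj
  have hvj : v * cs.simple j = cs.wordProd (L ++ l₁) := by
    rw [← hz, cs.simple_mul_simple_cancel_right]
  rw [hvj] at hlt
  nth_rewrite 1 [← hz] at hlt
  obtain ⟨a, ha, hae⟩ := exists_eraseIdx_of_length_mul_lt cs (L ++ l₁) (cs.isReflection_simple j) hlt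
  rw [hz] at hae
  -- A letter deleted from `L` leaves too few letters for the `k` boxes of the path; one deleted
  -- from `l₁` contradicts the choice of a shortest word.
  by_cases hlt' : a < L.length
  · rw [List.eraseIdx_append_of_lt_length hlt', cs.wordProd_append] at hae
    have hk' := hk
    rw [hae, pathOf_mul_wordProd _ hl₁] at hk'
    have := hk'.le_length_word
    rw [List.length_eraseIdx_of_lt hlt'] at this
    omega
  · rw [List.eraseIdx_append_of_length_le (not_lt.mp hlt'), cs.wordProd_append] at hae
    refine hmin _ ?_ ⟨l₁.eraseIdx (a - L.length), rfl, fun x hx => hl₁ x (List.mem_of_mem_eraseIdx hx), hae⟩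
    have := List.length_eraseIdx_le l₁ (a - L.length)
    simp
    omega

theorem IsRep.mem_minReps {b : ℤ → ℤ} {w : W} (h : IsRep cs p b w) (hb : InRectangle p b) :
    w ∈ minReps cs (grassJ p) := by
  intro j hj
  obtain ⟨k, hk⟩ := h.exists_builds (fun _ m => m + 1) 0
  have h1 := (h.exists_word hb hk).1
  have h2 := h.length_eq hb hk
  rw [← h1, ← pathOf_mul_simple w hj] at hk
  have h3 := HasSize.le_length hk
  have h4 := cs.length_mul_simple_ne w j
  omega

/-! ### Descents, Bruhat order and the recursion in the quotient. -/

theorem simple_mul_mem_minReps_iff {u : W} (hu : u ∈ minReps cs (grassJ p)) (i : Fin n) :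
    cs.simple i * u ∈ minReps cs (grassJ p) ↔
      Addable (diag p i) (pathOf cs p u) ∨ Removable (diag p i) (pathOf cs p u) := by
  have hrep := isRep_of_mem_minReps hu
  have hrect := inRectangle_pathOf cs p u
  constructor
  · intro h
    by_contra hn
    rw [not_or] at hn
    obtain ⟨k, hk⟩ := exists_hasSize_pathOf cs p u
    -- At a straight place `s_i u = u s_j`, which has the right descent `j` in `J`.
    obtain ⟨j, hj, he⟩ := hrep.exists_simple_mul_eq hrect hk hn.1 hn.2
    have h1 := h j hj
    have h2 := hu j hj
    rw [he, cs.simple_mul_simple_cancel_right] at h1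
    omega
  · rintro (h | h)
    · exact (hrep.add_simple h).mem_minReps (hrect.toggle i)
    · exact (hrep.remove_simple h).mem_minReps (hrect.toggle i)

theorem isLeftDescent_iff_removable {u : W} (hu : u ∈ minReps cs (grassJ p)) (i : Fin n) :
    cs.IsLeftDescent u i ↔ Removable (diag p i) (pathOf cs p u) := by
  have hrep := isRep_of_mem_minReps hu
  have hrect := inRectangle_pathOf cs p u
  obtain ⟨k, hk⟩ := exists_hasSize_pathOf cs p u
  have hlen := hrep.length_eq hrect hk
  constructor
  · intro h
    by_contra hn
    rcases (simple_mul_mem_minReps_iff hu i).mp (simple_mul_mem_minReps cs hu h) with ha | hr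
    · have := (hrep.add_simple ha).length_eq (hrect.toggle i) (hk.add _ ha)
      have h' : cs.length (cs.simple i * u) < cs.length u := h
      omega
    · exact hn hr
  · intro h
    obtain ⟨z, hz, hkz⟩ := hk.exists_of_removable farComm_succ h
    have := (hrep.remove_simple h).length_eq (hrect.toggle i) hz
    change cs.length (cs.simple i * u) < cs.length u
    omega

/-- Containment of diagrams implies the Bruhat order. -/
theorem IsRep.bruhatLE {k : ℕ} {c : ℤ → ℤ} {u : W} (hu : IsRep cs p c u) :
    ∀ {b : ℤ → ℤ} {v : W}, IsRep cs p b v → InRectangle p b → HasSize b k → c ≤ b →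
      BruhatLE cs u v := by
  induction k with
  | zero =>
    intro b v hv hb hk hle
    rcases hv.exists_removable hb with ⟨rfl, rfl⟩ | ⟨i, hi⟩
    · obtain rfl := le_antisymm hle hu.ground_le
      rw [hu.unique farComm_diagMul hv]
      exact Relation.ReflTransGen.refl
    · obtain ⟨z, _, hz⟩ := hk.exists_of_removable farComm_succ hi
      omega
  | succ k ih =>
    intro b v hv hb hk hle
    by_cases hbc : b ≤ c
    · obtain rfl := le_antisymm hle hbc
      rw [hu.unique farComm_diagMul hv]
      exact Relation.ReflTransGen.refl
    obtain ⟨d₀, hd₀⟩ : ∃ d, c d < b d := by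
      by_contra hn
      exact hbc fun d => not_lt.mp fun h => hn ⟨d, h⟩
    obtain ⟨d, hr, hlt⟩ := hv.exists_removable_of_lt hu.isPath hu.ground_le hd₀
    obtain ⟨i, rfl⟩ := hb.exists_diag hr
    obtain ⟨z, hz, hkz⟩ := hk.exists_of_removable farComm_succ hr
    obtain rfl : k = z := by omega
    have hle' : c ≤ toggle (diag p i) b := by
      refine le_of_eq_of_ne hle _ (fun x => toggle_of_ne b) (fun _ _ => rfl) ?_
      rw [hr.toggle_self]; omega
    have hv' := hv.remove_simple hr
    refine Relation.ReflTransGen.tail (ih hv' (hb.toggle i) hz hle')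
      ⟨?_, cs.simple i, cs.isReflection_simple i, cs.simple_mul_simple_cancel_left i⟩
    rw [hv'.length_eq (hb.toggle i) hz, hv.length_eq hb hk]
    exact Nat.lt_succ_self k

/-- The Bruhat order implies containment of diagrams. -/
theorem pathOf_le_of_bruhatLE {u v : W} (hv : v ∈ minReps cs (grassJ p)) (h : BruhatLE cs u v) :
    pathOf cs p u ≤ pathOf cs p v := by
  obtain ⟨k, hk⟩ := exists_hasSize_pathOf cs p v
  obtain ⟨_, l, hl, _, hsub⟩ :=
    (isRep_of_mem_minReps hv).exists_word (inRectangle_pathOf cs p v) hk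
  obtain ⟨l', hl', rfl⟩ := exists_sublist_of_bruhatLE cs h l hl
  exact hsub l' hl'

theorem isRelativeRFamily_pathR (cs : CoxeterSystem (CoxeterMatrix.A n) W) (p : Fin n) :
    IsRelativeRFamily cs (grassJ p) (-1)
      fun u v => pathR (pathOf cs p (v : W)) (pathOf cs p (u : W)) where
  eq_zero u v h := by
    obtain ⟨k, hk⟩ := exists_hasSize_pathOf cs p (v : W)
    refine pathR_eq_zero hk fun hle => h ?_
    exact (isRep_of_mem_minReps u.2).bruhatLE (isRep_of_mem_minReps v.2)
      (inRectangle_pathOf cs p _) hk hle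
  eq_one u := pathR_self (exists_hasSize_pathOf cs p (u : W)).choose_spec
  eq_of_descent u v i _ hv hu := by
    have hk := (exists_hasSize_pathOf cs p (v : W)).choose_spec
    rw [pathR_of_removable hk ((isLeftDescent_iff_removable v.2 i).mp hv),
      deodharOp_of_removable ((isLeftDescent_iff_removable u.2 i).mp hu)]
    simp only [down, pathOf_simple_mul]
  eq_of_not_mem u v i _ hv hu hm := by
    have hk := (exists_hasSize_pathOf cs p (v : W)).choose_spec
    rw [isLeftDescent_iff_removable u.2] at hu
    rw [simple_mul_mem_minReps_iff u.2, not_or] at hm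
    rw [pathR_of_removable hk ((isLeftDescent_iff_removable v.2 i).mp hv),
      deodharOp_of_not hu hm.1]
    simp only [down, pathOf_simple_mul]
    -- The factor `X - 1 - x` is `X` at `x = -1`.
    ring
  eq_of_mem u v i _ hv hu hm := by
    have hk := (exists_hasSize_pathOf cs p (v : W)).choose_spec
    rw [isLeftDescent_iff_removable u.2] at hu
    have ha := ((simple_mul_mem_minReps_iff u.2 i).mp hm).resolve_right hu
    rw [pathR_of_removable hk ((isLeftDescent_iff_removable v.2 i).mp hv),
      deodharOp_of_addable ha]
    simp only [down, pathOf_simple_mul]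

theorem relativeR_eq_pathR (cs : CoxeterSystem (CoxeterMatrix.A n) W) (p : Fin n)
    (u v : minReps cs (grassJ p)) :
    relativeR cs (grassJ p) (-1) u v = pathR (pathOf cs p (v : W)) (pathOf cs p (u : W)) := by
  -- The path recursion itself proves existence, so the default value 0 does not occur.
  have h : ∃ R, IsRelativeRFamily cs (grassJ p) (-1) R := ⟨_, isRelativeRFamily_pathR cs p⟩
  rw [relativeR, dif_pos h, h.choose_spec.unique cs (isRelativeRFamily_pathR cs p)]

end PathAction

/-! ### From Young diagrams and skew shapes to lattice paths. -/

section Diagrams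

/-- `b` is the lattice path of the set of boxes `D`. -/
def IsBoundary (D : Set (ℕ × ℕ)) (b : ℤ → ℤ) : Prop :=
  ground ≤ b ∧ ∀ i j : ℕ, (i, j) ∈ D ↔ (i : ℤ) < b ((i : ℤ) - j)

theorem isBoundary_empty : IsBoundary ∅ ground := by
  refine ⟨le_rfl, fun i j => ?_⟩
  refine iff_of_false (Set.notMem_empty _) ?_
  change ¬ ((i : ℤ) < max ((i : ℤ) - j) 0)
  omega

/-- The box and its four neighbours pin the path down to `i`, `i`, `i + 1` on the diagonals around
`i - j`. In row or column 0 the missing neighbour is replaced by the bound from the ground path. -/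
theorem IsBoundary.toggle {D : Set (ℕ × ℕ)} {b : ℤ → ℤ} (h : IsBoundary D b) (hb : IsPath b)
    {i j : ℕ} (hij : (i, j) ∉ D) (hup : ∀ k, i = k + 1 → (k, j) ∈ D)
    (hleft : ∀ k, j = k + 1 → (i, k) ∈ D) (hdown : (i + 1, j) ∉ D) (hright : (i, j + 1) ∉ D) :
    IsBoundary (insert (i, j) D) (toggle ((i : ℤ) - j) b) := by
  obtain ⟨hg, hD⟩ := h
  have g : ∀ d, max d 0 ≤ b d := hg
  rw [hD] at hij hdown hright
  have e1 : ((i + 1 : ℕ) : ℤ) - j = (i : ℤ) - j + 1 := by push_cast; ring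
  have e2 : (i : ℤ) - ((j + 1 : ℕ) : ℤ) = (i : ℤ) - j - 1 := by push_cast; ring
  rw [e1] at hdown
  rw [e2] at hright
  have p1 := hb ((i : ℤ) - j)
  have p2 := hb.left ((i : ℤ) - j)
  have hu : (i : ℤ) ≤ b ((i : ℤ) - j - 1) := by
    rcases i with _ | k
    · have := g (((0 : ℕ) : ℤ) - j - 1)
      push_cast at this ⊢
      omega
    · have := (hD k j).mp (hup k rfl)
      rw [show ((k + 1 : ℕ) : ℤ) - j - 1 = (k : ℤ) - j by push_cast; ring]
      push_cast
      omega
  have hl : (i : ℤ) + 1 ≤ b ((i : ℤ) - j + 1) := by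
    rcases j with _ | k
    · have := g ((i : ℤ) - ((0 : ℕ) : ℤ) + 1)
      push_cast at this ⊢
      omega
    · have := (hD i k).mp (hleft k rfl)
      rw [show (i : ℤ) - ((k + 1 : ℕ) : ℤ) + 1 = (i : ℤ) - k by push_cast; ring]
      omega
  push_cast at hdown
  have ha : Addable ((i : ℤ) - j) b := ⟨by omega, by omega⟩
  refine ⟨hg.trans (le_toggle_of_addable ha), fun x y => ?_⟩
  rw [Set.mem_insert_iff, hD, Prod.mk.injEq]
  by_cases hxy : (x : ℤ) - y = (i : ℤ) - j
  · rw [hxy, ha.toggle_self]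
    omega
  · rw [toggle_of_ne b hxy]
    have : ¬ (x = i ∧ y = j) := by rintro ⟨rfl, rfl⟩; exact hxy rfl
    tauto

variable {n : ℕ} {W : Type*} [Group W]

theorem gen_eq_simple (cs : CoxeterSystem (CoxeterMatrix.A n) W) {k : ℕ} (h : k < n) :
    gen cs k = cs.simple ⟨k, h⟩ := by
  rw [gen, dif_pos h]

theorem rowWord_succ (cs : CoxeterSystem (CoxeterMatrix.A n) W) (p : Fin n) (i l : ℕ) :
    rowWord cs p i (l + 1) = rowWord cs p i l * gen cs ((p : ℕ) + i - l) := by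
  simp [rowWord, List.range_succ]

/-- The boxes of `lam` in the rows before row `r`, and the first `l` boxes of row `r`. -/
def readBoxes (lam : YoungDiagram) (r l : ℕ) : Set (ℕ × ℕ) :=
  {c | c ∈ lam ∧ (c.1 < r ∨ c.1 = r ∧ c.2 < l)}

theorem insert_readBoxes {lam : YoungDiagram} {r l : ℕ} (h : l < lam.rowLen r) :
    insert (r, l) (readBoxes lam r l) = readBoxes lam r (l + 1) := by
  have h' := YoungDiagram.mem_iff_lt_rowLen.mpr h
  ext ⟨x, y⟩
  simp only [readBoxes, Set.mem_insert_iff, Set.mem_ofPred_eq, Prod.mk.injEq]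
  constructor
  · rintro (⟨rfl, rfl⟩ | ⟨h1, h2⟩)
    · exact ⟨h', by omega⟩
    · exact ⟨h1, by omega⟩
  · rintro ⟨h1, h2⟩
    by_cases hxy : x = r ∧ y = l
    · exact Or.inl hxy
    · exact Or.inr ⟨h1, by omega⟩

theorem readBoxes_rowLen (lam : YoungDiagram) (r : ℕ) :
    readBoxes lam r (lam.rowLen r) = readBoxes lam (r + 1) 0 := by
  ext ⟨x, y⟩
  simp only [readBoxes, Set.mem_ofPred_eq, YoungDiagram.mem_iff_lt_rowLen]
  constructor
  · rintro ⟨h1, h2⟩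
    exact ⟨h1, by omega⟩
  · rintro ⟨h1, h2⟩
    refine ⟨h1, ?_⟩
    rcases (by omega : x < r ∨ x = r) with h | rfl
    · exact Or.inl h
    · exact Or.inr ⟨rfl, h1⟩

theorem readBoxes_colLen (lam : YoungDiagram) :
    readBoxes lam (lam.colLen 0) 0 = {c | c ∈ lam} := by
  ext ⟨x, y⟩
  simp only [readBoxes, Set.mem_ofPred_eq, and_iff_left_iff_imp]
  intro h
  exact Or.inl (YoungDiagram.mem_iff_lt_colLen.mp
    (lam.up_left_mem le_rfl (Nat.zero_le y) h))

/-- The inverse in the definition of the element makes the labels act in reading order, each adding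
its own box. -/
theorem isBoundary_pathOf_row (cs : CoxeterSystem (CoxeterMatrix.A n) W) {p : Fin n}
    {lam : YoungDiagram} (hfit : FitsIn p lam) {r : ℕ} {w : W}
    (h : IsBoundary (readBoxes lam r 0) (pathOf cs p w)) (l : ℕ) (hl : l ≤ lam.rowLen r) :
    IsBoundary (readBoxes lam r l) (pathOf cs p ((rowWord cs p r l)⁻¹ * w)) := by
  induction l with
  | zero => simpa [rowWord] using h
  | succ l ih =>
    have hmem : (r, l) ∈ lam := YoungDiagram.mem_iff_lt_rowLen.mpr hl
    have hrl := hfit (r, l) hmem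
    simp only at hrl
    have hk : (p : ℕ) + r - l < n := by omega
    -- The natural subtraction is not truncated, since `l ≤ p` in the rectangle.
    have hd : diag p ⟨(p : ℕ) + r - l, hk⟩ = (r : ℤ) - l := by
      simp only [diag]; omega
    rw [rowWord_succ, mul_inv_rev, gen_eq_simple cs hk, cs.inv_simple, mul_assoc,
      pathOf_simple_mul, hd, ← insert_readBoxes hl]
    refine (ih (by omega)).toggle (isPath_pathOf _) ?_ ?_ ?_ ?_ ?_
    · simp [readBoxes]
    · rintro k rfl
      exact ⟨lam.up_left_mem (Nat.le_succ k) le_rfl hmem, Or.inl (Nat.lt_succ_self k)⟩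
    · rintro k rfl
      exact ⟨lam.up_left_mem le_rfl (Nat.le_succ k) hmem, Or.inr ⟨rfl, Nat.lt_succ_self k⟩⟩
    · simp [readBoxes]
    · simp [readBoxes]

/-- The lattice path of the element attached to a diagram is the boundary of the diagram. -/
theorem HasShape.isBoundary {cs : CoxeterSystem (CoxeterMatrix.A n) W} {p : Fin n} {w : W}
    {lam : YoungDiagram} (h : HasShape cs p w lam) :
    IsBoundary {c | c ∈ lam} (pathOf cs p w) := by
  obtain ⟨hfit, rfl⟩ := h
  have key : ∀ r : ℕ, IsBoundary (readBoxes lam r 0) (pathOf cs p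
      ((((List.range r).map fun i => rowWord cs p i (lam.rowLen i)).prod)⁻¹)) := by
    intro r
    induction r with
    | zero =>
      have : readBoxes lam 0 0 = ∅ := by ext; simp [readBoxes]
      rw [this]
      simpa [pathOf_one] using isBoundary_empty
    | succ r ih =>
      have := isBoundary_pathOf_row cs hfit ih _ le_rfl
      rw [readBoxes_rowLen] at this
      simpa [List.range_succ] using this
  rw [← readBoxes_colLen]
  exact key _

theorem mem_skewBoxes_iff {lam mu : YoungDiagram} {b c : ℤ → ℤ}
    (hb : IsBoundary {c | c ∈ lam} b) (hc : IsBoundary {c | c ∈ mu} c) (x d : ℤ) :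
    (x, x - d) ∈ skewBoxes lam mu ↔ c d ≤ x ∧ x < b d := by
  constructor
  · rintro ⟨⟨i, j⟩, hm, he⟩
    obtain ⟨rfl, he⟩ := Prod.mk.inj he
    obtain rfl : d = (i : ℤ) - j := by simp only at he; omega
    rw [Finset.mem_sdiff] at hm
    exact ⟨not_lt.mp fun h => hm.2 ((hc.2 i j).mpr h), (hb.2 i j).mp hm.1⟩
  · rintro ⟨h1, h2⟩
    have h3 : max d 0 ≤ c d := hc.1 d
    obtain ⟨i, rfl⟩ := Int.eq_ofNat_of_zero_le (show 0 ≤ x by omega)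
    obtain ⟨j, hj⟩ := Int.eq_ofNat_of_zero_le (show 0 ≤ (i : ℤ) - d by omega)
    obtain rfl : d = (i : ℤ) - j := by omega
    refine ⟨(i, j), Finset.mem_sdiff.mpr ⟨(hb.2 i j).mpr h2, fun h => ?_⟩, by simp⟩
    exact absurd ((hc.2 i j).mp h) (not_lt.mpr h1)

theorem SameSkewShape.exists_skewTranslate {lam mu lam' mu' : YoungDiagram}
    (h : SameSkewShape lam mu lam' mu') {b c b' c' : ℤ → ℤ}
    (hb : IsBoundary {c | c ∈ lam} b) (hc : IsBoundary {c | c ∈ mu} c)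
    (hb' : IsBoundary {c | c ∈ lam'} b') (hc' : IsBoundary {c | c ∈ mu'} c')
    (hle : c ≤ b) (hle' : c' ≤ b') : ∃ δ τ, SkewTranslate δ τ b c b' c' := by
  obtain ⟨⟨t₁, t₂⟩, ht⟩ := h
  -- On each diagonal the skew boxes fill the rows from `c d` to `b d - 1`. Two such intervals that
  -- are translates are both empty or have translated ends, which are the two alternatives.
  refine ⟨t₁ - t₂, t₁, fun d => ?_⟩
  have key : ∀ x : ℤ, (c' (d + (t₁ - t₂)) ≤ x + t₁ ∧ x + t₁ < b' (d + (t₁ - t₂))) ↔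
      (c d ≤ x ∧ x < b d) := by
    intro x
    rw [← mem_skewBoxes_iff hb hc, ← mem_skewBoxes_iff hb' hc', ht,
      show ((x + t₁, x + t₁ - (d + (t₁ - t₂))) : ℤ × ℤ) = (x, x - d) + (t₁, t₂) by
        ext <;> simp; ring]
    constructor
    · rintro ⟨a, ha, hae⟩
      rwa [← add_right_cancel hae]
    · intro hx
      exact ⟨_, hx, rfl⟩
  have h1 : c d ≤ b d := hle d
  have h2 : c' (d + (t₁ - t₂)) ≤ b' (d + (t₁ - t₂)) := hle' _
  have k1 := key (c d)
  have k2 := key (c d - 1)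
  have k3 := key (b d)
  have k4 := key (b d - 1)
  have k5 := key (c' (d + (t₁ - t₂)) - t₁)
  omega

end Diagrams

end RelativeR

theorem mainTheorem7 {n n' : ℕ} {W W' : Type*} [Group W] [Group W']
    (cs : CoxeterSystem (CoxeterMatrix.A n) W) (cs' : CoxeterSystem (CoxeterMatrix.A n') W')
    (p : Fin n) (p' : Fin n')
    (u v : RelativeR.minReps cs (RelativeR.grassJ p))
    (u' v' : RelativeR.minReps cs' (RelativeR.grassJ p'))
    (huv : RelativeR.BruhatLT cs (u : W) (v : W))
    (huv' : RelativeR.BruhatLT cs' (u' : W') (v' : W'))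
    (lam mu lam' mu' : YoungDiagram)
    (hv : RelativeR.HasShape cs p (v : W) lam) (hu : RelativeR.HasShape cs p (u : W) mu)
    (hv' : RelativeR.HasShape cs' p' (v' : W') lam')
    (hu' : RelativeR.HasShape cs' p' (u' : W') mu')
    (hshape : RelativeR.SameSkewShape lam mu lam' mu') :
    RelativeR.relativeR cs (RelativeR.grassJ p) (-1) u v =
      RelativeR.relativeR cs' (RelativeR.grassJ p') (-1) u' v' := by
  have hle := RelativeR.pathOf_le_of_bruhatLE v.2 huv.1
  have hle' := RelativeR.pathOf_le_of_bruhatLE v'.2 huv'.1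
  obtain ⟨δ, τ, hs⟩ := hshape.exists_skewTranslate hv.isBoundary hu.isBoundary
    hv'.isBoundary hu'.isBoundary hle hle'
  rw [RelativeR.relativeR_eq_pathR, RelativeR.relativeR_eq_pathR]
  exact RelativeR.pathR_eq_of_skewTranslate _
    (RelativeR.exists_hasSize_pathOf cs p (v : W)).choose_spec
    (RelativeR.exists_hasSize_pathOf cs' p' (v' : W')).choose_spec
    (RelativeR.exists_hasSize_pathOf cs p (u : W)).choose_spec
    (RelativeR.exists_hasSize_pathOf cs' p' (u' : W')).choose_spec rfl hle hle' hs
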